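/- A network $\mathcal N=(\nu,\epsilon,\mu,c,\mathcal A,S,R)$ is a finite directed acyclic multigraph with node set $\nu$, edge set $\epsilon$, capacities $c:\epsilon\to\mathbb Z_{>0}$, finite message set $\mu$, finite alphabet $\mathcal A$, and maps $S,R:\nu\to 2^{\mu}$ giving the messages that each node generates and demands. Assume that every message is demanded by at least one node, that for every message $m\in R(x)$ there is a directed path to $x$ from some node generating $m$, and that no node both generates and demands the same message. A fractional routing code over a finite field $F$ with $|F|\ge|\mathcal A|$ has source dimensions $k_m\in\mathbb Z_{>0}$ $(m\in\mu)$ and an edge dimension $n\in\mathbb Z_{>0}$. Message $m$ is a vector in $F^{k_m}$ and edge $e$ carries a vector in $F^{n c(e)}$. The vector on an edge, and each decoded message at a node, is a function of the messages generated by the tail of the edge (respectively, by the node) and of the vectors on its in-edges, each output coordinate being a copy of a fixed input coordinate or inactive (constantly $0$). The code is a solution if for every choice of the messages every node decodes correctly all messages it demands. The network routing capacity region $\mathcal C_r\subset\mathbb R^{\mu}$ is the closure of the set of all rate vectors $(k_m/n)_{m\in\mu}$ of fractional routing solutions. For $m\in\mu$, let $\mathcal T_m$ be the set of Steiner trees for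 $m$: sets $T\subseteq\epsilon$ such that every node has at most one in-edge in $T$, every edge of $T$ can be reached inside $T$ from a node generating $m$, and so can every node demanding $m$. (If a single node generates $m$, these are the directed trees rooted at that node that span all nodes demanding $m$.) Let $\mathcal P_r$ be the set of all families $x=(x_m(T))_{m\in\mu,\,T\in\mathcal T_m}$ of nonnegative reals with $$\sum_{m\in\mu}\ \sum_{T\in\mathcal T_m,\ e\in T} x_m(T)\le c(e)\qquad\text{for all } e\in\epsilon ,$$ and let $\psi_r(x)=\big(\sum_{T\in\mathcal T_m}x_m(T)\big)_{m\in\mu}$. **Theorem.** For every such network: 1. $\mathcal C_r\subseteq\mathbb R_+^{\mu}$, and $\mathcal C_r$ is a bounded rational polytope, that is, the bounded solution set of a finite system of linear inequalities with rational coefficients; its vertices are rational. 2. $\mathcal P_r$ is a bounded rational polytope with finitely many vertices, all of them rational; $\mathcal C_r=\psi_r(\mathcal P_r)$; and $\mathcal C_r$ is the convex hull of the images under $\psi_r$ of the vertices of $\mathcal P_r$. 3. $\mathcal C_r$ is computable: there are algorithms (total computable functions) which, given any such network as a finite list of data, output the list of all vertices of $\mathcal P_r$ and the list of all vertices of $\mathcal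 C_r$, respectively (repetitions allowed), with rational coordinates given as fractions. -/

import Mathlib

/-! ## Capacitated networks -/

/-- A capacitated network: a directed acyclic multigraph with node set `V`, edge set `E`, message set
`M` and alphabet `A`, with positive integral edge capacities, a source mapping and a receiver
mapping. Finiteness of `V`, `E`, `M`, `A` is assumed where networks are quantified over. -/
structure Network (V E M A : Type*) where
  /-- the edge `e` goes from `tail e` to `head e` -/
  tail : E → V
  head : E → V
  cap : E → ℕ
  cap_pos : ∀ e, 0 < cap e
  /-- `sources x` is the set of messages generated by the node `x` -/
  sources : V → Finset M
  /-- `receivers x` is the set of messages demanded by the node `x` -/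
  receivers : V → Finset M
  acyclic : ∀ x, ¬ Relation.TransGen (fun u v => ∃ e, tail e = u ∧ head e = v) x x

namespace Network

variable {V E M A : Type*}

/-- There is a directed path from `u` to `v` all of whose edges belong to `T`. -/
def ReachIn (N : Network V E M A) (T : Set E) (u v : V) : Prop :=
  Relation.ReflTransGen (fun a b => ∃ e ∈ T, N.tail e = a ∧ N.head e = b) u v

/-- Non-degenerate networks: every demand for a message can be reached from a node generating that
message, and no message is both generated and demanded by the same node. -/
structure Nondegenerate (N : Network V E M A) : Prop where
  path : ∀ v m, m ∈ N.receivers v → ∃ s, m ∈ N.sources s ∧ N.ReachIn Set.univ s v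
  disjoint : ∀ v m, m ∈ N.sources v → m ∉ N.receivers v

/-- Every message is demanded by at least one node. -/
def AllDemanded (N : Network V E M A) : Prop :=
  ∀ m, ∃ v, m ∈ N.receivers v

/-! ## Fractional network codes -/

/-- What the node `x` sees: the symbol vectors of the messages it generates and the symbol vectors
on its in-edges. -/
abbrev NodeInput (N : Network V E M A) (F : Type) (k : M → ℕ) (n : ℕ) (x : V) : Type _ :=
  ((m : {m : M // m ∈ N.sources x}) → Fin (k m.1) → F) ×
    ((e : {e : E // N.head e = x}) → Fin (n * N.cap e.1) → F)

/-- A fractional network code over `F`: a source dimension vector `k`, an edge dimension `n`,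
fractional edge functions and fractional decoding functions. -/
structure FractionalCode (N : Network V E M A) (F : Type) where
  k : M → ℕ
  k_pos : ∀ m, 0 < k m
  n : ℕ
  n_pos : 0 < n
  edgeFn : (e : E) → N.NodeInput F k n (N.tail e) → Fin (n * N.cap e) → F
  decFn : (x : V) → (m : M) → m ∈ N.receivers x → N.NodeInput F k n x → Fin (k m) → F

/-- A routing function: every output coordinate is a copy of one fixed input coordinate, or is
inactive (carries the constant `0`). -/
def IsRoutingFn (N : Network V E M A) {F : Type} [Zero F] {k : M → ℕ} {n : ℕ} {x : V} {d : ℕ}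
    (g : N.NodeInput F k n x → Fin d → F) : Prop :=
  ∀ j : Fin d,
    (∃ m i, ∀ inp, g inp j = inp.1 m i) ∨
    (∃ e i, ∀ inp, g inp j = inp.2 e i) ∨
    (∀ inp, g inp j = 0)

namespace FractionalCode

variable {N : Network V E M A} {F : Type}

/-- The input of node `x` for the message assignment `a` and the edge symbol vectors `s`. -/
def input (c : N.FractionalCode F) (a : (m : M) → Fin (c.k m) → F)
    (s : (e : E) → Fin (c.n * N.cap e) → F) (x : V) : N.NodeInput F c.k c.n x :=
  (fun m => a m.1, fun e => s e.1)

/-- The code is a solution: for every message assignment `a`, the edge symbol vectors `s` that the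
edge functions produce (they exist and are unique because the network is acyclic) let every demand
be satisfied. -/
def IsSolution (c : N.FractionalCode F) : Prop :=
  ∀ a : (m : M) → Fin (c.k m) → F,
    ∃ s : (e : E) → Fin (c.n * N.cap e) → F,
      (∀ e, s e = c.edgeFn e (c.input a s (N.tail e))) ∧
      ∀ x m (h : m ∈ N.receivers x), c.decFn x m h (c.input a s x) = a m

/-- All edge functions and all decoding functions are routing functions. -/
def IsRouting [Zero F] (c : N.FractionalCode F) : Prop :=
  (∀ e, N.IsRoutingFn (c.edgeFn e)) ∧ ∀ x m (h : m ∈ N.receivers x), N.IsRoutingFn (c.decFn x m h)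

/-- The rate vector `(k_m / n)_m`. -/
noncomputable def rate (c : N.FractionalCode F) : M → ℝ :=
  fun m => (c.k m : ℝ) / (c.n : ℝ)

end FractionalCode

/-- The achievable routing rate vectors (over all finite fields with at least `|A|` elements). -/
def achievableRoutingRates (N : Network V E M A) : Set (M → ℝ) :=
  {r | ∃ (F : Type) (_ : Field F) (_ : Finite F) (c : N.FractionalCode F),
    Nat.card A ≤ Nat.card F ∧ c.IsRouting ∧ c.IsSolution ∧ r = c.rate}

/-- The network routing capacity region. -/
def routingRegion (N : Network V E M A) : Set (M → ℝ) :=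
  closure N.achievableRoutingRates

/-! ## Steiner trees and the packing polytope -/

/-- `T` is (the edge set of) a directed Steiner tree for the message `m`: every edge of `T` can be
reached inside `T` from a node generating `m`, every node has at most one in-edge in `T`, and every
node demanding `m` is reached inside `T` from a node generating `m`. If `m` is generated by a single
node, these are the trees rooted at that node that span all receivers of `m`; if `m` is generated by
several nodes, these are the trees that result from joining these nodes to a common root, without
the edges at that root. -/
structure IsSteinerTree (N : Network V E M A) (m : M) (T : Finset E) : Prop where
  rooted : ∀ e ∈ T, ∃ s, m ∈ N.sources s ∧ N.ReachIn (T : Set E) s (N.tail e)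
  inDegree_le_one : ∀ e ∈ T, ∀ e' ∈ T, N.head e = N.head e' → e = e'
  spans : ∀ v, m ∈ N.receivers v → ∃ s, m ∈ N.sources s ∧ N.ReachIn (T : Set E) s v

/-- The Steiner trees for the message `m`. -/
abbrev SteinerTree (N : Network V E M A) (m : M) : Type _ :=
  {T : Finset E // N.IsSteinerTree m T}

/-- The disjoint union, over the messages, of the sets of Steiner trees. -/
abbrev TreeIndex (N : Network V E M A) : Type _ :=
  (m : M) × N.SteinerTree m

noncomputable instance [Fintype E] (N : Network V E M A) (m : M) : Fintype (N.SteinerTree m) :=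
  Fintype.ofFinite _

open Classical in
/-- The polytope of fractional Steiner tree packings that respect the edge capacities. -/
def packingPolytope [Fintype E] [Fintype M] (N : Network V E M A) : Set (N.TreeIndex → ℝ) :=
  {x | (∀ t, 0 ≤ x t) ∧ ∀ e, ∑ t : N.TreeIndex, (if e ∈ t.2.1 then 1 else 0) * x t ≤ (N.cap e : ℝ)}

/-- The map summing the tree multiplicities of each message. -/
noncomputable def rateMap [Fintype E] (N : Network V E M A) : (N.TreeIndex → ℝ) →ₗ[ℝ] (M → ℝ) where
  toFun x m := ∑ T : N.SteinerTree m, x ⟨m, T⟩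
  map_add' x y := by
    funext m
    simp [Finset.sum_add_distrib]
  map_smul' a x := by
    funext m
    simp [Finset.mul_sum]

end Network

/-! ## Rational polytopes -/

/-- A bounded rational polytope: the bounded solution set of a finite system of linear inequalities
with rational coefficients. -/
structure IsBoundedRationalPolytope {ι : Type*} [Fintype ι] (S : Set (ι → ℝ)) : Prop where
  system : ∃ (r : ℕ) (B : Fin r → ι → ℚ) (b : Fin r → ℚ),
    S = {x | ∀ j, ∑ i, (B j i : ℝ) * x i ≤ (b j : ℝ)}
  bounded : Bornology.IsBounded S

/-- All coordinates of `x` are rational. -/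
def IsRationalPoint {ι : Type*} (x : ι → ℝ) : Prop :=
  ∀ i, ∃ q : ℚ, x i = (q : ℝ)

/-! ## Finite descriptions, as inputs and outputs of algorithms -/

/-- Descriptions of networks: the numbers of nodes, messages and letters; the list of all edges with
tail, head and capacity; the incidence tables of the source mapping and of the receiver mapping. -/
abbrev NetworkCode : Type :=
  ℕ × ℕ × ℕ × List (ℕ × ℕ × ℕ) × List (List Bool) × List (List Bool)

/-- The description of a network on numbered nodes, edges, messages and letters. -/
def Network.code {v e m a : ℕ} (N : Network (Fin v) (Fin e) (Fin m) (Fin a)) : NetworkCode :=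
  (v, m, a,
    List.ofFn fun i => ((N.tail i : ℕ), (N.head i : ℕ), N.cap i),
    List.ofFn fun x => List.ofFn fun i => decide (i ∈ N.sources x),
    List.ofFn fun x => List.ofFn fun i => decide (i ∈ N.receivers x))

/-- The pair `(p, q)` of natural numbers, with `q ≠ 0`, describes the rational number `p / q`. -/
def FracDescribes (c : ℕ × ℕ) (r : ℝ) : Prop :=
  0 < c.2 ∧ r = (c.1 : ℝ) / (c.2 : ℝ)

/-- Descriptions of nonnegative rational vectors: the list of coordinates. -/
abbrev VectorCode : Type := List (ℕ × ℕ)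

def VectorDescribes {d : ℕ} (L : VectorCode) (y : Fin d → ℝ) : Prop :=
  List.Forall₂ FracDescribes L (List.ofFn y)

/-- Descriptions of Steiner tree packings: a table of entries, each consisting of (the number of) a
message, the incidence vector of a tree, and the multiplicity of that tree. -/
abbrev PackingCode : Type := List ((ℕ × List Bool) × (ℕ × ℕ))

/-- The table `L` runs through all Steiner trees of all messages and gives their multiplicities
in `x`. -/
def PackingDescribes {v e m a : ℕ} (N : Network (Fin v) (Fin e) (Fin m) (Fin a))
    (L : PackingCode) (x : N.TreeIndex → ℝ) : Prop :=
  ∃ ts : List N.TreeIndex, (∀ t, t ∈ ts) ∧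
    List.Forall₂ (fun entry t =>
      entry.1 = ((t.1 : ℕ), List.ofFn fun i => decide (i ∈ t.2.1)) ∧
        FracDescribes entry.2 (x t)) L ts

/-- The list `Ls` consists of descriptions of points of `S`, and every point of `S` is described
by a member of `Ls`. -/
def ListsPoints {C X : Type*} (describes : C → X → Prop) (Ls : List C) (S : Set X) : Prop :=
  (∀ L ∈ Ls, ∃ x ∈ S, describes L x) ∧ ∀ x ∈ S, ∃ L ∈ Ls, describes L x

/-! ## Polyhedra given by finitely many inequalities -/

universe w

section Polyhedra

open Filter Topology

variable {ι J : Type*} [Fintype ι]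

/-- The solution set of a system of linear inequalities. -/
def polyhedron (B : J → ι → ℝ) (b : J → ℝ) : Set (ι → ℝ) :=
  {x | ∀ j, B j ⬝ᵥ x ≤ b j}

theorem convex_polyhedron (B : J → ι → ℝ) (b : J → ℝ) : Convex ℝ (polyhedron B b) := by
  intro x hx y hy s t hs ht hst j
  have h1 := mul_le_mul_of_nonneg_left (hx j) hs
  have h2 := mul_le_mul_of_nonneg_left (hy j) ht
  have h3 : s * b j + t * b j = b j := by rw [← add_mul, hst, one_mul]
  simp only [dotProduct_add, dotProduct_smul, smul_eq_mul]
  linarith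

theorem isClosed_polyhedron (B : J → ι → ℝ) (b : J → ℝ) : IsClosed (polyhedron B b) := by
  have : polyhedron B b = ⋂ j, {x | B j ⬝ᵥ x ≤ b j} := by
    ext x; simp [polyhedron]
  rw [this]
  refine isClosed_iInter fun j => isClosed_le ?_ continuous_const
  unfold dotProduct
  fun_prop

/-- A point of a polyhedron is extreme if and only if the tight rows have trivial kernel. -/
theorem mem_extremePoints_polyhedron_iff [Finite J] (B : J → ι → ℝ) (b : J → ℝ) (x : ι → ℝ) :
    x ∈ (polyhedron B b).extremePoints ℝ ↔
      x ∈ polyhedron B b ∧ ∀ z, (∀ j, B j ⬝ᵥ x = b j → B j ⬝ᵥ z = 0) → z = 0 := by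
  rw [mem_extremePoints]
  refine and_congr_right fun hx => ⟨fun h z hz => ?_, fun h x₁ h₁ x₂ h₂ hseg => ?_⟩
  · have key : ∀ᶠ ε in 𝓝 (0 : ℝ), x + ε • z ∈ polyhedron B b := by
      refine eventually_all.2 fun j => ?_
      rcases eq_or_lt_of_le (hx j) with hj | hj
      · refine Eventually.of_forall fun ε => ?_
        simp [dotProduct_add, hz j hj, hj]
      · have hc : Tendsto (fun ε : ℝ => B j ⬝ᵥ (x + ε • z)) (𝓝 0) (𝓝 (B j ⬝ᵥ x)) := by
          have : Continuous fun ε : ℝ => B j ⬝ᵥ (x + ε • z) := by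
            simp only [dotProduct_add, dotProduct_smul, smul_eq_mul]
            fun_prop
          simpa using this.tendsto 0
        exact (hc.eventually (gt_mem_nhds hj)).mono fun ε hε => hε.le
    have key' : ∀ᶠ ε in 𝓝 (0 : ℝ), x + (-ε) • z ∈ polyhedron B b := by
      have : Tendsto (fun ε : ℝ => -ε) (𝓝 0) (𝓝 0) := by simpa using (continuous_neg.tendsto (0 : ℝ))
      exact this.eventually key
    obtain ⟨ε, ⟨hε1, hε2⟩, hε⟩ :=
      (((key.and key').filter_mono nhdsWithin_le_nhds).and
        (self_mem_nhdsWithin : Set.Ioi (0 : ℝ) ∈ 𝓝[>] 0)).exists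
    have hs : x ∈ openSegment ℝ (x + ε • z) (x + (-ε) • z) := by
      refine ⟨1 / 2, 1 / 2, by norm_num, by norm_num, by norm_num, ?_⟩
      ext i
      simp
      ring
    have := (h _ hε1 _ hε2 hs).1
    have h0 : ε • z = 0 := by simpa using this
    exact (smul_eq_zero.1 h0).resolve_left (ne_of_gt hε)
  · obtain ⟨s, t, hs, ht, hst, rfl⟩ := hseg
    have tight : ∀ j, B j ⬝ᵥ (s • x₁ + t • x₂) = b j → B j ⬝ᵥ x₁ = b j ∧ B j ⬝ᵥ x₂ = b j := by
      intro j hj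
      simp only [dotProduct_add, dotProduct_smul, smul_eq_mul] at hj
      have e : b j = s * b j + t * b j := by rw [← add_mul, hst, one_mul]
      have h1 : 0 ≤ s * (b j - B j ⬝ᵥ x₁) := mul_nonneg hs.le (sub_nonneg.2 (h₁ j))
      have h2 : 0 ≤ t * (b j - B j ⬝ᵥ x₂) := mul_nonneg ht.le (sub_nonneg.2 (h₂ j))
      have h3 : s * (b j - B j ⬝ᵥ x₁) = 0 := by nlinarith
      have h4 : t * (b j - B j ⬝ᵥ x₂) = 0 := by nlinarith
      have h5 := (mul_eq_zero.1 h3).resolve_left hs.ne'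
      have h6 := (mul_eq_zero.1 h4).resolve_left ht.ne'
      constructor <;> linarith
    constructor
    · refine sub_eq_zero.1 (h _ fun j hj => ?_)
      rw [dotProduct_sub, hj, (tight j hj).1, sub_self]
    · refine sub_eq_zero.1 (h _ fun j hj => ?_)
      rw [dotProduct_sub, hj, (tight j hj).2, sub_self]

theorem finite_extremePoints_polyhedron [Finite J] (B : J → ι → ℝ) (b : J → ℝ) :
    ((polyhedron B b).extremePoints ℝ).Finite := by
  refine Set.Finite.of_finite_image (f := fun x => {j | B j ⬝ᵥ x = b j}) (Set.toFinite _) ?_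
  intro x hx y hy hxy
  refine sub_eq_zero.1 (((mem_extremePoints_polyhedron_iff B b x).1 hx).2 _ fun j hj => ?_)
  have hj' : B j ⬝ᵥ y = b j := (Set.ext_iff.1 hxy j).1 hj
  rw [dotProduct_sub, hj, hj', sub_self]

/-- The rows of `B` in `I` have a nontrivial kernel vector or a left inverse. -/
theorem exists_kernel_or_leftInverse [Fintype J] [DecidableEq ι] (B : J → ι → ℚ) (I : Set J) :
    (∃ z : ι → ℚ, z ≠ 0 ∧ ∀ j ∈ I, B j ⬝ᵥ z = 0) ∨
      ∃ Y : ι → J → ℚ, (∀ i, ∀ j ∉ I, Y i j = 0) ∧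
        ∀ i k, ∑ j, Y i j * B j k = if i = k then 1 else 0 := by
  classical
  let B' : Matrix J ι ℚ := fun j i => if j ∈ I then B j i else 0
  have hB' : ∀ z j, B'.mulVecLin z j = if j ∈ I then B j ⬝ᵥ z else 0 := by
    intro z j
    rw [Matrix.mulVecLin_apply]
    by_cases hj : j ∈ I <;> simp [B', Matrix.mulVec, dotProduct, hj]
  by_cases hker : LinearMap.ker B'.mulVecLin = ⊥
  · right
    obtain ⟨g, hg⟩ := LinearMap.exists_leftInverse_of_injective _ hker
    refine ⟨fun i j => if j ∈ I then g (Pi.single j 1) i else 0, fun i j hj => by simp [hj],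
      fun i k => ?_⟩
    have h1 : g (B'.mulVecLin (Pi.single k 1)) i = if i = k then 1 else 0 := by
      have := LinearMap.congr_fun hg (Pi.single k 1)
      simp only [LinearMap.comp_apply, LinearMap.id_apply] at this
      rw [this, Pi.single_apply]
    rw [← h1]
    have h2 : B'.mulVecLin (Pi.single k 1) = ∑ j, B' j k • (Pi.single j 1 : J → ℚ) := by
      ext j
      simp [Finset.sum_apply, Pi.single_apply]
    rw [h2, map_sum, Finset.sum_apply]
    refine Finset.sum_congr rfl fun j _ => ?_
    by_cases hj : j ∈ I <;> simp [B', hj, mul_comm]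
  · left
    obtain ⟨z, hz, hz0⟩ := (Submodule.ne_bot_iff _).1 hker
    refine ⟨z, hz0, fun j hj => ?_⟩
    have := congrFun (LinearMap.mem_ker.1 hz) j
    simpa [hB', hj] using this

theorem eq_sum_of_leftInverse {K : Type*} [Field K] [Fintype J] [DecidableEq ι] {B : J → ι → K}
    {Y : ι → J → K} (hY : ∀ i k, ∑ j, Y i j * B j k = if i = k then 1 else 0) (x : ι → K) (i : ι) :
    x i = ∑ j, Y i j * (B j ⬝ᵥ x) := by
  simp only [dotProduct, Finset.mul_sum]
  rw [Finset.sum_comm]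
  simp only [← mul_assoc, ← Finset.sum_mul, hY]
  simp

omit [Fintype ι] in
theorem leftInverse_cast [Fintype J] [DecidableEq ι] {B : J → ι → ℚ} {Y : ι → J → ℚ}
    (hY : ∀ i k, ∑ j, Y i j * B j k = if i = k then 1 else 0) (i k : ι) :
    ∑ j, (Y i j : ℝ) * (B j k : ℝ) = if i = k then 1 else 0 := by
  have := congrArg (fun q : ℚ => (q : ℝ)) (hY i k)
  push_cast at this
  rw [this]
  split_ifs <;> simp

/-- For rational rows, extreme points are the points with a rational left inverse of the tight
rows. -/
theorem mem_extremePoints_polyhedron_rat_iff [Fintype J] [DecidableEq ι] (B : J → ι → ℚ)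
    (b : J → ℝ) (x : ι → ℝ) :
    x ∈ (polyhedron (fun j i => (B j i : ℝ)) b).extremePoints ℝ ↔
      x ∈ polyhedron (fun j i => (B j i : ℝ)) b ∧
        ∃ Y : ι → J → ℚ, (∀ i j, Y i j ≠ 0 → (fun i => (B j i : ℝ)) ⬝ᵥ x = b j) ∧
          ∀ i k, ∑ j, Y i j * B j k = if i = k then 1 else 0 := by
  rw [mem_extremePoints_polyhedron_iff]
  refine and_congr_right fun _ => ⟨fun h => ?_, ?_⟩
  · rcases exists_kernel_or_leftInverse B {j | (fun i => (B j i : ℝ)) ⬝ᵥ x = b j} with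
      ⟨z, hz0, hz⟩ | ⟨Y, hY0, hY⟩
    · refine absurd (h (fun i => (z i : ℝ)) fun j hj => ?_) fun h0 => hz0 ?_
      · have := hz j hj
        simp only [dotProduct] at this ⊢
        exact_mod_cast this
      · ext i
        simpa using congrFun h0 i
    · exact ⟨Y, fun i j hij => not_not.1 fun hj => hij (hY0 i j hj), hY⟩
  · rintro ⟨Y, hY0, hY⟩ z hz
    ext i
    rw [eq_sum_of_leftInverse (B := fun j i => (B j i : ℝ)) (leftInverse_cast hY) z i]
    refine Finset.sum_eq_zero fun j _ => ?_
    by_cases hj : Y i j = 0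
    · simp [hj]
    · rw [hz j (hY0 i j hj), mul_zero]

theorem isRationalPoint_of_mem_extremePoints [Finite J] (B : J → ι → ℚ) (b : J → ℚ) {x : ι → ℝ}
    (hx : x ∈ (polyhedron (fun j i => (B j i : ℝ)) (fun j => (b j : ℝ))).extremePoints ℝ) :
    IsRationalPoint x := by
  classical
  cases nonempty_fintype J
  obtain ⟨-, Y, hY0, hY⟩ := (mem_extremePoints_polyhedron_rat_iff B _ x).1 hx
  intro i
  refine ⟨∑ j, Y i j * b j, ?_⟩
  rw [eq_sum_of_leftInverse (B := fun j i => (B j i : ℝ)) (leftInverse_cast hY) x i]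
  push_cast
  refine Finset.sum_congr rfl fun j _ => ?_
  by_cases hj : Y i j = 0
  · simp [hj]
  · rw [hY0 i j hj]

theorem IsBoundedRationalPolytope.of_polyhedron [Finite J] (B : J → ι → ℚ) (b : J → ℚ)
    {S : Set (ι → ℝ)} (hS : S = polyhedron (fun j i => (B j i : ℝ)) (fun j => (b j : ℝ)))
    (hb : Bornology.IsBounded S) : IsBoundedRationalPolytope S := by
  obtain ⟨r, ⟨e⟩⟩ := Finite.exists_equiv_fin J
  refine ⟨⟨r, fun j => B (e.symm j), fun j => b (e.symm j), ?_⟩, hb⟩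
  rw [hS]
  ext x
  exact ⟨fun h j => h _, fun h j => by simpa using! h (e j)⟩

/-- Rational vectors have a common denominator. -/
theorem exists_common_denominator {ι : Type*} [Finite ι] (q : ι → ℚ) :
    ∃ n : ℕ, 0 < n ∧ ∃ z : ι → ℤ, ∀ i, q i = (z i : ℚ) / n := by
  cases nonempty_fintype ι
  refine ⟨∏ i, (q i).den, Finset.prod_pos fun i _ => (q i).den_pos, ?_⟩
  choose c hc using fun i => Finset.dvd_prod_of_mem (fun i => (q i).den) (Finset.mem_univ i)
  refine ⟨fun i => (q i).num * c i, fun i => ?_⟩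
  have h0 : ((∏ i, (q i).den : ℕ) : ℚ) ≠ 0 := by
    exact_mod_cast Finset.prod_ne_zero_iff.2 fun i _ => (q i).den_nz
  rw [eq_div_iff h0, hc i]
  push_cast
  rw [← mul_assoc, Rat.mul_den_eq_num]

/-! ### Fourier–Motzkin elimination -/

/-- A finite system of upper and lower bounds for one unknown is solvable if and only if every
nonnegative combination of two inequalities that eliminates the unknown is satisfied. -/
theorem exists_forall_mul_add_nonpos_iff [Finite J] (a s : J → ℝ) :
    (∃ t : ℝ, ∀ j, a j * t + s j ≤ 0) ↔
      (∀ j, a j = 0 → s j ≤ 0) ∧ ∀ p q, 0 < a p → a q < 0 → -a q * s p + a p * s q ≤ 0 := by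
  cases nonempty_fintype J
  constructor
  · rintro ⟨t, ht⟩
    refine ⟨fun j hj => by simpa [hj] using ht j, fun p q hp hq => ?_⟩
    nlinarith [mul_le_mul_of_nonneg_left (ht p) (neg_pos.2 hq).le,
      mul_le_mul_of_nonneg_left (ht q) hp.le]
  · rintro ⟨h0, h⟩
    have up : ∀ p, 0 < a p → ∀ t, t ≤ -s p / a p → a p * t + s p ≤ 0 := by
      intro p hp t ht
      rw [le_div_iff₀ hp] at ht
      linarith
    have lo : ∀ q, a q < 0 → ∀ t, -s q / a q ≤ t → a q * t + s q ≤ 0 := by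
      intro q hq t ht
      rw [div_le_iff_of_neg hq] at ht
      linarith
    classical
    by_cases hn : (Finset.univ.filter fun q => a q < 0).Nonempty
    · obtain ⟨q, hq, hmax⟩ := Finset.exists_max_image _ (fun q => -s q / a q) hn
      simp only [Finset.mem_filter, Finset.mem_univ, true_and] at hq hmax
      refine ⟨-s q / a q, fun j => ?_⟩
      rcases lt_trichotomy (a j) 0 with hj | hj | hj
      · exact lo j hj _ (hmax j hj)
      · simpa [hj] using h0 j hj
      · refine up j hj _ ?_
        rw [le_div_iff₀ hj, div_mul_eq_mul_div, div_le_iff_of_neg hq]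
        linarith [h j q hj hq]
    · by_cases hp : (Finset.univ.filter fun p => 0 < a p).Nonempty
      · obtain ⟨p, hp, hmin⟩ := Finset.exists_min_image _ (fun p => -s p / a p) hp
        simp only [Finset.mem_filter, Finset.mem_univ, true_and] at hp hmin
        refine ⟨-s p / a p, fun j => ?_⟩
        rcases lt_trichotomy (a j) 0 with hj | hj | hj
        · exact absurd ⟨j, by simpa using hj⟩ hn
        · simpa [hj] using h0 j hj
        · exact up j hj _ (hmin j hj)
      · refine ⟨0, fun j => ?_⟩
        rcases lt_trichotomy (a j) 0 with hj | hj | hj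
        · exact absurd ⟨j, by simpa using hj⟩ hn
        · simpa [hj] using h0 j hj
        · exact absurd ⟨j, by simpa using hj⟩ hp

/-- Projections of rational polyhedra are rational polyhedra. -/
theorem exists_polyhedron_eq_projection (n : ℕ) : ∀ {J : Type w} [Finite J] (A : J → Fin n → ℚ)
    (B : J → ι → ℚ) (b : J → ℚ), ∃ (K : Type w) (_ : Finite K) (B' : K → ι → ℚ) (b' : K → ℚ),
      {y : ι → ℝ | ∃ x : Fin n → ℝ, ∀ j, ∑ k, (A j k : ℝ) * x k + ∑ i, (B j i : ℝ) * y i ≤ b j} =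
        polyhedron (fun j i => (B' j i : ℝ)) (fun j => (b' j : ℝ)) := by
  induction n with
  | zero =>
    intro J _ A B b
    refine ⟨J, ‹_›, B, b, ?_⟩
    ext y
    simp [polyhedron, dotProduct]
  | succ n ih =>
    intro J _ A B b
    let K := {j // A j 0 = 0} ⊕ {p // 0 < A p 0} × {q // A q 0 < 0}
    let comb : (J → ℚ) → K → ℚ := fun f => Sum.elim (fun j => f j)
      (fun pq => -A pq.2 0 * f pq.1 + A pq.1 0 * f pq.2)
    obtain ⟨K', hK', B', b', h⟩ := ih (J := K) (fun k l => comb (fun j => A j l.succ) k)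
      (fun k i => comb (fun j => B j i) k) (comb b)
    refine ⟨K', hK', B', b', ?_⟩
    rw [← h]
    ext y
    simp only [Set.mem_ofPred_eq, Fin.exists_fin_succ_pi, Fin.sum_univ_succ, Fin.cons_zero,
      Fin.cons_succ]
    rw [exists_comm]
    refine exists_congr fun x => ?_
    have := exists_forall_mul_add_nonpos_iff (fun j => (A j 0 : ℝ))
      (fun j => ∑ k : Fin n, (A j k.succ : ℝ) * x k + ∑ i, (B j i : ℝ) * y i - b j)
    have e1 : (∃ t : ℝ, ∀ j, (A j 0 : ℝ) * t + ∑ k : Fin n, (A j k.succ : ℝ) * x k +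
        ∑ i, (B j i : ℝ) * y i ≤ b j) ↔ ∃ t : ℝ, ∀ j, (A j 0 : ℝ) * t +
        (∑ k : Fin n, (A j k.succ : ℝ) * x k + ∑ i, (B j i : ℝ) * y i - b j) ≤ 0 := by
      refine exists_congr fun t => forall_congr' fun j => ?_
      constructor <;> intro h <;> linarith
    rw [e1, this]
    simp only [K, Sum.forall, Prod.forall, Subtype.forall, comb, Sum.elim_inl, Sum.elim_inr,
      Rat.cast_eq_zero, Rat.cast_pos, Rat.cast_lt_zero, Rat.cast_add, Rat.cast_mul, Rat.cast_neg]
    refine and_congr (forall_congr' fun j => forall_congr' fun hj => ?_) ?_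
    · constructor <;> intro h <;> linarith
    · have e2 : ∀ p q, (∑ l : Fin n, (-(A q 0 : ℝ) * (A p l.succ : ℝ) + (A p 0 : ℝ) * (A q l.succ : ℝ))
          * x l + ∑ i, (-(A q 0 : ℝ) * (B p i : ℝ) + (A p 0 : ℝ) * (B q i : ℝ)) * y i) =
          -(A q 0 : ℝ) * (∑ k : Fin n, (A p k.succ : ℝ) * x k + ∑ i, (B p i : ℝ) * y i) +
          (A p 0 : ℝ) * (∑ k : Fin n, (A q k.succ : ℝ) * x k + ∑ i, (B q i : ℝ) * y i) := by
        intro p q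
        simp only [add_mul, Finset.sum_add_distrib, mul_add, Finset.mul_sum, mul_assoc]
        ring
      simp only [e2]
      constructor
      · intro h p hp q hq
        linarith [h p q hp hq]
      · intro h p q hp hq
        linarith [h p hp q hq]

end Polyhedra

/-! ## Steiner trees -/

namespace Network

open Filter Topology

variable {V E M A : Type*} (N : Network V E M A)

/-- The node `v` generates `m` or has an in-edge in `T`. -/
def Serves (m : M) (T : Set E) (v : V) : Prop :=
  m ∈ N.sources v ∨ ∃ e ∈ T, N.head e = v

theorem wellFounded_edges [Finite V] : WellFounded fun e' e : E => N.head e' = N.tail e := by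
  let r : V → V → Prop := Relation.TransGen fun u v => ∃ e, N.tail e = u ∧ N.head e = v
  have : Std.Irrefl r := ⟨N.acyclic⟩
  have : IsTrans V r := ⟨fun _ _ _ => Relation.TransGen.trans⟩
  have hr : WellFounded r := Finite.wellFounded_of_trans_of_irrefl r
  refine Subrelation.wf (r := InvImage r N.head) ?_ (InvImage.wf N.head hr)
  intro e' e h
  exact Relation.TransGen.single ⟨e, h.symm, rfl⟩

variable {N} in
theorem Serves.of_reachIn {m : M} {T : Set E} {s v : V} (hs : m ∈ N.sources s)
    (h : N.ReachIn T s v) : N.Serves m T v := by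
  rcases Relation.ReflTransGen.cases_tail h with rfl | ⟨_, -, e, he, -, hv⟩
  · exact Or.inl hs
  · exact Or.inr ⟨e, he, hv⟩

/-- In an acyclic network, being a Steiner tree is a local condition. -/
theorem isSteinerTree_iff [Finite V] (m : M) (T : Finset E) :
    N.IsSteinerTree m T ↔ (∀ e ∈ T, N.Serves m T (N.tail e)) ∧
      (∀ e ∈ T, ∀ e' ∈ T, N.head e = N.head e' → e = e') ∧
      ∀ v, m ∈ N.receivers v → N.Serves m T v := by
  constructor
  · intro h
    refine ⟨fun e he => ?_, h.inDegree_le_one, fun v hv => ?_⟩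
    · obtain ⟨s, hs, hr⟩ := h.rooted e he
      exact .of_reachIn hs hr
    · obtain ⟨s, hs, hr⟩ := h.spans v hv
      exact .of_reachIn hs hr
  · rintro ⟨h1, h2, h3⟩
    have rooted : ∀ e, e ∈ T → ∃ s, m ∈ N.sources s ∧ N.ReachIn (T : Set E) s (N.tail e) := by
      intro e
      induction e using N.wellFounded_edges.induction with
      | _ e ih =>
        intro he
        rcases h1 e he with hs | ⟨e', he', hh⟩
        · exact ⟨_, hs, .refl⟩
        · obtain ⟨s, hs, hr⟩ := ih e' hh he'
          exact ⟨s, hs, hr.tail ⟨e', he', rfl, hh⟩⟩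
    refine ⟨rooted, h2, fun v hv => ?_⟩
    rcases h3 v hv with hs | ⟨e, he, rfl⟩
    · exact ⟨_, hs, .refl⟩
    · obtain ⟨s, hs, hr⟩ := rooted e he
      exact ⟨s, hs, hr.tail ⟨e, he, rfl, rfl⟩⟩

/-- Every set of edges that spans the receivers of a message contains a Steiner tree. -/
theorem exists_steinerTree_subset [Finite V] [Finite E] {m : M} {C : Set E}
    (h1 : ∀ e ∈ C, N.Serves m C (N.tail e)) (h2 : ∀ v, m ∈ N.receivers v → N.Serves m C v) :
    ∃ T : Finset E, (T : Set E) ⊆ C ∧ N.IsSteinerTree m T := by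
  classical
  cases nonempty_fintype E
  have hc : ∀ v, ∃ o : Option E, (∀ e ∈ o, e ∈ C ∧ N.head e = v) ∧
      ((∃ e ∈ C, N.head e = v) → ∃ e, o = some e) := by
    intro v
    by_cases hv : ∃ e ∈ C, N.head e = v
    · obtain ⟨e, he, hev⟩ := hv
      exact ⟨some e, by simpa using ⟨he, hev⟩, fun _ => ⟨e, rfl⟩⟩
    · exact ⟨none, by simp, fun h => absurd h hv⟩
  choose f hf1 hf2 using hc
  let T : Finset E := Finset.univ.filter fun e => f (N.head e) = some e
  have hT : ∀ e, e ∈ T ↔ f (N.head e) = some e := by simp [T]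
  have hTC : (T : Set E) ⊆ C := fun e he => (hf1 _ e ((hT e).1 he)).1
  have key : ∀ v, N.Serves m C v → N.Serves m T v := by
    rintro v (h | h)
    · exact Or.inl h
    · obtain ⟨e, he⟩ := hf2 v h
      have hv := (hf1 v e he).2
      exact Or.inr ⟨e, (hT e).2 (hv.symm ▸ he), hv⟩
  refine ⟨T, hTC, (N.isSteinerTree_iff m T).2
    ⟨fun e he => key _ (h1 e (hTC he)), fun e he e' he' hh => ?_, fun v hv => key v (h2 v hv)⟩⟩
  rw [hT] at he he'
  rw [hh] at he
  exact Option.some_injective _ (he.symm.trans he')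

variable {N} in
theorem Nondegenerate.exists_steinerTree [Finite V] [Finite E] (hN : N.Nondegenerate) (m : M) :
    ∃ T : Finset E, N.IsSteinerTree m T := by
  let C : Set E := {e | ∃ s, m ∈ N.sources s ∧ N.ReachIn Set.univ s (N.tail e)}
  have key : ∀ s v, m ∈ N.sources s → N.ReachIn Set.univ s v → N.Serves m C v := by
    intro s v hs h
    rcases Relation.ReflTransGen.cases_tail h with rfl | ⟨u, hu, e, -, rfl, hv⟩
    · exact Or.inl hs
    · exact Or.inr ⟨e, ⟨s, hs, hu⟩, hv⟩
  obtain ⟨T, -, hT⟩ := N.exists_steinerTree_subset (m := m) (C := C)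
    (fun e ⟨s, hs, h⟩ => key s _ hs h)
    (fun v hv => let ⟨s, hs, h⟩ := hN.path v m hv; key s v hs h)
  exact ⟨T, hT⟩

variable {N} in
theorem IsSteinerTree.nonempty {m : M} {T : Finset E} (hT : N.IsSteinerTree m T)
    (hN : N.Nondegenerate) (hd : N.AllDemanded) : T.Nonempty := by
  obtain ⟨v, hv⟩ := hd m
  obtain ⟨s, hs, h⟩ := hT.spans v hv
  rcases Serves.of_reachIn hs h with h | ⟨e, he, -⟩
  · exact absurd hv (hN.disjoint v m h)
  · exact ⟨e, he⟩

/-! ## From routing solutions to Steiner tree packings -/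

section Packing

variable [Fintype E] [Fintype M]

open Classical in
theorem exists_packing_of_trees {k : M → ℕ} {n : ℕ} (hn : 0 < n)
    (tr : ((m : M) × Fin (k m)) → N.TreeIndex) (h1 : ∀ p, (tr p).1 = p.1)
    (hcard : ∀ e, (Finset.univ.filter fun p => e ∈ (tr p).2.1).card ≤ n * N.cap e) :
    (fun m => (k m : ℝ) / n) ∈ N.rateMap '' N.packingPolytope := by
  have hn' : (0 : ℝ) < n := by exact_mod_cast hn
  refine ⟨fun t => ((Finset.univ.filter fun p => tr p = t).card : ℝ) / n,
    ⟨fun t => by positivity, fun e => ?_⟩, ?_⟩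
  · have : ∑ t : N.TreeIndex, (if e ∈ t.2.1 then 1 else 0) *
        (((Finset.univ.filter fun p => tr p = t).card : ℝ) / n) =
        ((Finset.univ.filter fun p => e ∈ (tr p).2.1).card : ℝ) / n := by
      rw [Finset.card_eq_sum_card_fiberwise (f := tr) (t := Finset.univ) (by simp), Nat.cast_sum,
        Finset.sum_div]
      refine Finset.sum_congr rfl fun t _ => ?_
      by_cases ht : e ∈ t.2.1
      · rw [if_pos ht, one_mul, Finset.filter_filter]
        congr 3
        ext p
        simp only [Finset.mem_filter, Finset.mem_univ, true_and]
        exact ⟨fun h => ⟨h ▸ ht, h⟩, fun h => h.2⟩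
      · rw [if_neg ht, zero_mul, Finset.filter_filter, Finset.filter_false_of_mem]
        · simp
        · rintro p - ⟨hp, rfl⟩
          exact ht hp
    rw [this, div_le_iff₀ hn', mul_comm]
    exact_mod_cast hcard e
  · funext m
    change ∑ T : N.SteinerTree m, ((Finset.univ.filter fun p => tr p = ⟨m, T⟩).card : ℝ) / n = _
    rw [← Finset.sum_div]
    congr 1
    have hk : k m = (Finset.univ.filter fun p : (m : M) × Fin (k m) => p.1 = m).card := by
      have : (Finset.univ.filter fun p : (m : M) × Fin (k m) => p.1 = m) =
          (Finset.univ : Finset (Fin (k m))).map ⟨fun i => ⟨m, i⟩, fun i j h => by simpa using h⟩ := by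
        ext ⟨m', i⟩
        simp only [Finset.mem_filter, Finset.mem_univ, true_and, Finset.mem_map]
        constructor
        · rintro rfl
          exact ⟨i, rfl⟩
        · rintro ⟨j, hj⟩
          exact (congrArg Sigma.fst hj).symm
      rw [this, Finset.card_map, Finset.card_univ, Fintype.card_fin]
    have hmaps : ∀ p ∈ (Finset.univ.filter fun p : (m : M) × Fin (k m) => p.1 = m),
        tr p ∈ (Finset.univ : Finset (N.SteinerTree m)).map
          ⟨fun T => (⟨m, T⟩ : N.TreeIndex), fun T T' h => by simpa using h⟩ := by
      intro p hp
      simp only [Finset.mem_filter, Finset.mem_univ, true_and] at hp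
      rcases htp : tr p with ⟨m', T⟩
      have := h1 p
      rw [htp, hp] at this
      obtain rfl : m' = m := this
      exact Finset.mem_map.2 ⟨T, Finset.mem_univ _, rfl⟩
    rw [hk, Finset.card_eq_sum_card_fiberwise hmaps, Finset.sum_map, Nat.cast_sum]
    refine Finset.sum_congr rfl fun T _ => ?_
    rw [Finset.filter_filter]
    congr 2
    ext p
    simp only [Finset.mem_filter, Finset.mem_univ, true_and]
    refine ⟨fun h => ⟨?_, h⟩, fun h => h.2⟩
    rw [← h1 p, h]

variable {N} in
open Classical in
/-- The message assignments with a single nonzero symbol show which slots of the edges carry that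
symbol; these edges contain a Steiner tree. -/
theorem FractionalCode.rate_mem_image [Finite V] {F : Type} [Field F]
    (c : N.FractionalCode F) (hr : c.IsRouting) (hs : c.IsSolution) :
    c.rate ∈ N.rateMap '' N.packingPolytope := by
  let unit : ((m : M) × Fin (c.k m)) → (m : M) → Fin (c.k m) → F :=
    fun p m i => if (⟨m, i⟩ : (m : M) × Fin (c.k m)) = p then 1 else 0
  have hunit : ∀ p m i, unit p m i ≠ 0 → (⟨m, i⟩ : (m : M) × Fin (c.k m)) = p := by
    intro p m i h
    by_contra hp
    exact h (if_neg hp)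
  choose s hedge hdec using fun p => hs (unit p)
  let C : ((m : M) × Fin (c.k m)) → Set E := fun p => {e | ∃ j, s p e j ≠ 0}
  have serves : ∀ p {v d} (g : N.NodeInput F c.k c.n v → Fin d → F), N.IsRoutingFn g → ∀ j,
      g (c.input (unit p) (s p) v) j ≠ 0 → N.Serves p.1 (C p) v := by
    intro p v d g hg j hj
    rcases hg j with ⟨m, i, h⟩ | ⟨e, i, h⟩ | h
    · rw [h] at hj
      rw [← hunit p _ _ hj]
      exact Or.inl m.2
    · rw [h] at hj
      exact Or.inr ⟨e.1, ⟨i, hj⟩, e.2⟩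
    · exact absurd (h _) hj
  have hC1 : ∀ p, ∀ e ∈ C p, N.Serves p.1 (C p) (N.tail e) := by
    rintro p e ⟨j, hj⟩
    rw [hedge p e] at hj
    exact serves p _ (hr.1 e) j hj
  have hC2 : ∀ p v, p.1 ∈ N.receivers v → N.Serves p.1 (C p) v := by
    intro p v hv
    refine serves p _ (hr.2 v p.1 hv) p.2 ?_
    rw [hdec p v p.1 hv]
    simp [unit]
  have disj : ∀ e j p p', s p e j ≠ 0 → s p' e j ≠ 0 → p = p' := by
    intro e
    induction e using N.wellFounded_edges.induction with
    | _ e ih =>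
      intro j p p' hp hp'
      rw [hedge] at hp hp'
      rcases hr.1 e j with ⟨m, i, h⟩ | ⟨e', i, h⟩ | h
      · rw [h] at hp hp'
        exact (hunit p _ _ hp).symm.trans (hunit p' _ _ hp')
      · rw [h] at hp hp'
        exact ih e'.1 e'.2 i p p' hp hp'
      · exact absurd (h _) hp
  choose T hTC hT using fun p => N.exists_steinerTree_subset (hC1 p) (hC2 p)
  refine N.exists_packing_of_trees c.n_pos (fun p => ⟨p.1, T p, hT p⟩) (fun _ => rfl) fun e => ?_
  choose slot hslot using fun p : {p // e ∈ T p} => hTC p.1 p.2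
  rw [← Fintype.card_subtype, ← Fintype.card_fin (c.n * N.cap e)]
  refine Fintype.card_le_of_injective slot fun p p' h => Subtype.ext ?_
  exact disj e (slot p) _ _ (hslot p) (h ▸ hslot p')

end Packing

/-! ## From Steiner tree packings to routing solutions -/

section Codes

variable [Fintype M]

open Classical in
/-- Symbols that travel along Steiner trees, with enough room on every edge, form a routing
solution. -/
theorem mem_achievableRoutingRates_of_trees [Finite V] [Finite A] {k : M → ℕ}
    (hk : ∀ m, 0 < k m) {n : ℕ} (hn : 0 < n) (tr : ((m : M) × Fin (k m)) → Finset E)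
    (htr : ∀ p, N.IsSteinerTree p.1 (tr p))
    (hcard : ∀ e, (Finset.univ.filter fun p => e ∈ tr p).card ≤ n * N.cap e) :
    (fun m => (k m : ℝ) / n) ∈ N.achievableRoutingRates := by
  obtain ⟨q, hq, hqp⟩ := Nat.exists_infinite_primes (Nat.card A)
  have : Fact q.Prime := ⟨hqp⟩
  let F := ZMod q
  have hσ : ∀ e, Nonempty ({p // e ∈ tr p} ↪ Fin (n * N.cap e)) := by
    intro e
    refine Function.Embedding.nonempty_of_card_le ?_
    rw [Fintype.card_subtype, Fintype.card_fin]
    exact hcard e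
  let σ := fun e => (hσ e).some
  let g : (v : V) → ((m : M) × Fin (k m)) → N.NodeInput F k n v → F := fun v p inp =>
    if h : ∃ e ∈ tr p, N.head e = v then
      inp.2 ⟨h.choose, h.choose_spec.2⟩ (σ h.choose ⟨p, h.choose_spec.1⟩)
    else if h : p.1 ∈ N.sources v then inp.1 ⟨p.1, h⟩ p.2 else 0
  let c : N.FractionalCode F :=
    { k := k
      k_pos := hk
      n := n
      n_pos := hn
      edgeFn := fun e inp j =>
        if h : ∃ p : {p // e ∈ tr p}, σ e p = j then g (N.tail e) h.choose.1 inp else 0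
      decFn := fun x m _ inp i => g x ⟨m, i⟩ inp }
  have hg : ∀ v p, (∃ m i, ∀ inp, g v p inp = inp.1 m i) ∨ (∃ e i, ∀ inp, g v p inp = inp.2 e i) ∨
      ∀ inp, g v p inp = 0 := by
    intro v p
    by_cases h : ∃ e ∈ tr p, N.head e = v
    · exact Or.inr (Or.inl ⟨⟨h.choose, h.choose_spec.2⟩, σ h.choose ⟨p, h.choose_spec.1⟩,
        fun inp => dif_pos h⟩)
    · by_cases h' : p.1 ∈ N.sources v
      · exact Or.inl ⟨⟨p.1, h'⟩, p.2, fun inp => (dif_neg h).trans (dif_pos h')⟩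
      · exact Or.inr (Or.inr fun inp => (dif_neg h).trans (dif_neg h'))
  refine ⟨F, inferInstance, inferInstance, c, ?_, ⟨fun e j => ?_, fun x m h i => hg x ⟨m, i⟩⟩,
    fun a => ?_, rfl⟩
  · rw [Nat.card_zmod]
    exact hq
  · by_cases h : ∃ p : {p // e ∈ tr p}, σ e p = j
    · have he : ∀ inp, c.edgeFn e inp j = g (N.tail e) h.choose.1 inp := fun inp => dif_pos h
      simp only [he]
      exact hg _ _
    · exact Or.inr (Or.inr fun inp => dif_neg h)
  · let s : (e : E) → Fin (n * N.cap e) → F := fun e j =>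
      if h : ∃ p : {p // e ∈ tr p}, σ e p = j then a h.choose.1.1 h.choose.1.2 else 0
    have hs : ∀ e p, s e (σ e p) = a p.1.1 p.1.2 := by
      intro e p
      have h : ∃ p' : {p // e ∈ tr p}, σ e p' = σ e p := ⟨p, rfl⟩
      have h' : h.choose = p := (σ e).injective h.choose_spec
      have : s e (σ e p) = a h.choose.1.1 h.choose.1.2 := dif_pos h
      rw [this, h']
    have hgs : ∀ v p, N.Serves p.1 (tr p) v → g v p (c.input a s v) = a p.1 p.2 := by
      intro v p hv
      by_cases h : ∃ e ∈ tr p, N.head e = v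
      · have : g v p (c.input a s v) = s h.choose (σ h.choose ⟨p, h.choose_spec.1⟩) := dif_pos h
        rw [this, hs]
      · have h' : p.1 ∈ N.sources v := hv.resolve_right h
        exact (dif_neg h).trans (dif_pos h')
    have hloc := fun p => (N.isSteinerTree_iff _ _).1 (htr p)
    refine ⟨s, fun e => ?_, fun x m h => ?_⟩
    · funext j
      by_cases h : ∃ p : {p // e ∈ tr p}, σ e p = j
      · have h1 : c.edgeFn e (c.input a s (N.tail e)) j =
          g (N.tail e) h.choose.1 (c.input a s (N.tail e)) := dif_pos h
        rw [h1, hgs _ _ ((hloc h.choose.1).1 e h.choose.2)]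
        exact dif_pos h
      · have h1 : c.edgeFn e (c.input a s (N.tail e)) j = 0 := dif_neg h
        rw [h1]
        exact dif_neg h
    · funext i
      exact hgs x ⟨m, i⟩ ((hloc ⟨m, i⟩).2.2 x h)

open Classical in
/-- Integral packings into the multiplied capacities give routing solutions. -/
theorem mem_achievableRoutingRates_of_multiplicities [Finite V] [Fintype E] [Finite A]
    (μ : N.TreeIndex → ℕ) {n : ℕ} (hn : 0 < n)
    (hpos : ∀ m, 0 < ∑ T : N.SteinerTree m, μ ⟨m, T⟩)
    (hcap : ∀ e, ∑ t : N.TreeIndex, (if e ∈ t.2.1 then 1 else 0) * μ t ≤ n * N.cap e) :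
    (fun m => ((∑ T : N.SteinerTree m, μ ⟨m, T⟩ : ℕ) : ℝ) / n) ∈ N.achievableRoutingRates := by
  have hφ : ∀ m, Nonempty (((T : N.SteinerTree m) × Fin (μ ⟨m, T⟩)) ≃
      Fin (∑ T : N.SteinerTree m, μ ⟨m, T⟩)) := by
    intro m
    exact ⟨Fintype.equivFinOfCardEq (by simp)⟩
  let φ := fun m => (hφ m).some
  refine N.mem_achievableRoutingRates_of_trees hpos hn (fun p => ((φ p.1).symm p.2).1.1)
    (fun p => ((φ p.1).symm p.2).1.2) fun e => le_trans (le_of_eq ?_) (hcap e)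
  let Φ : ((t : N.TreeIndex) × Fin (μ t)) ≃
      ((m : M) × Fin (∑ T : N.SteinerTree m, μ ⟨m, T⟩)) :=
    (Equiv.sigmaAssoc fun (m : M) (T : N.SteinerTree m) => Fin (μ ⟨m, T⟩)).trans
      (Equiv.sigmaCongrRight φ)
  rw [Finset.card_filter, ← Φ.sum_comp, Fintype.sum_sigma]
  refine Finset.sum_congr rfl fun t _ => ?_
  have hΦ : ∀ y, ((φ (Φ ⟨t, y⟩).1).symm (Φ ⟨t, y⟩).2).1 = t.2 := by
    intro y
    change ((φ t.1).symm (φ t.1 ⟨t.2, y⟩)).1 = _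
    rw [Equiv.symm_apply_apply]
  simp only [hΦ]
  by_cases ht : e ∈ t.2.1 <;> simp [ht]

end Codes

/-! ## The capacity region as the image of the packing polytope -/

section Region

variable [Fintype E] [Fintype M]

open Classical in
/-- The rows of the inequality system of the packing polytope. -/
noncomputable def packingRows : N.TreeIndex ⊕ E → N.TreeIndex → ℚ :=
  Sum.elim (fun t t' => if t' = t then -1 else 0) (fun e t => if e ∈ t.2.1 then 1 else 0)

/-- The right-hand sides of the inequality system of the packing polytope. -/
def packingBounds : N.TreeIndex ⊕ E → ℚ :=
  Sum.elim (fun _ => 0) (fun e => N.cap e)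

theorem packingPolytope_eq_polyhedron : N.packingPolytope =
    polyhedron (fun j i => (N.packingRows j i : ℝ)) (fun j => (N.packingBounds j : ℝ)) := by
  ext x
  simp only [packingPolytope, polyhedron, packingRows, packingBounds, dotProduct,
    Set.mem_ofPred_eq, Sum.forall, Sum.elim_inl, Sum.elim_inr]
  refine and_congr (forall_congr' fun t => ?_) (forall_congr' fun e => ?_)
  · simp [apply_ite (Rat.cast : ℚ → ℝ), ite_mul]
  · simp [apply_ite (Rat.cast : ℚ → ℝ)]

variable {N}

theorem isBounded_packingPolytope (h : ∀ t : N.TreeIndex, t.2.1.Nonempty) :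
    Bornology.IsBounded N.packingPolytope := by
  classical
  refine (Metric.isBounded_Icc (0 : N.TreeIndex → ℝ)
    (fun t => (N.cap (h t).choose : ℝ))).subset fun x hx => ⟨hx.1, fun t => ?_⟩
  refine le_trans ?_ (hx.2 (h t).choose)
  have := Finset.single_le_sum (f := fun t' : N.TreeIndex =>
    (if (h t).choose ∈ t'.2.1 then 1 else 0) * x t') (fun t' _ => ?_) (Finset.mem_univ t)
  · simpa [(h t).choose_spec] using this
  · exact mul_nonneg (by split_ifs <;> norm_num) (hx.1 t')

theorem isCompact_packingPolytope (h : ∀ t : N.TreeIndex, t.2.1.Nonempty) :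
    IsCompact N.packingPolytope := by
  refine Metric.isCompact_of_isClosed_isBounded ?_ (isBounded_packingPolytope h)
  rw [packingPolytope_eq_polyhedron]
  exact isClosed_polyhedron _ _

theorem continuous_rateMap : Continuous N.rateMap :=
  LinearMap.continuous_of_finiteDimensional _

open Classical in
/-- The packings with positive multiplicities that do not exhaust any edge. -/
def strictPackings (N : Network V E M A) : Set (N.TreeIndex → ℝ) :=
  {x | (∀ t, 0 < x t) ∧ ∀ e, ∑ t : N.TreeIndex, (if e ∈ t.2.1 then 1 else 0) * x t < (N.cap e : ℝ)}

theorem isOpen_strictPackings : IsOpen N.strictPackings := by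
  classical
  have : N.strictPackings = (⋂ t, {x | 0 < x t}) ∩ ⋂ e, {x | ∑ t : N.TreeIndex,
      (if e ∈ t.2.1 then 1 else 0) * x t < (N.cap e : ℝ)} := by
    ext x
    simp [strictPackings]
  rw [this]
  refine (isOpen_iInter_of_finite fun t => isOpen_lt continuous_const (continuous_apply t)).inter
    (isOpen_iInter_of_finite fun e => isOpen_lt (by fun_prop) continuous_const)

theorem strictPackings_nonempty : N.strictPackings.Nonempty := by
  classical
  refine ⟨fun _ => 1 / (Fintype.card N.TreeIndex + 1), fun t => by positivity, fun e => ?_⟩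
  have h1 : ∑ t : N.TreeIndex, (if e ∈ t.2.1 then (1 : ℝ) else 0) *
      (1 / (Fintype.card N.TreeIndex + 1)) ≤
      ∑ t : N.TreeIndex, (1 / (Fintype.card N.TreeIndex + 1) : ℝ) := by
    refine Finset.sum_le_sum fun t _ => ?_
    have : (0 : ℝ) ≤ 1 / (Fintype.card N.TreeIndex + 1) := by positivity
    split_ifs
    · rw [one_mul]
    · rwa [zero_mul]
  have h2 : (1 : ℝ) ≤ N.cap e := by exact_mod_cast N.cap_pos e
  refine (h1.trans_lt ?_).trans_le h2
  rw [Finset.sum_const, Finset.card_univ, nsmul_eq_mul, mul_one_div, div_lt_one (by positivity)]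
  linarith

theorem packingPolytope_subset_closure : N.packingPolytope ⊆ closure N.strictPackings := by
  classical
  intro x hx
  obtain ⟨y, hy⟩ := N.strictPackings_nonempty
  refine closure_mono ?_ (segment_subset_closure_openSegment (left_mem_segment ℝ x y))
  rintro _ ⟨a, b, ha, hb, hab, rfl⟩
  refine ⟨fun t => ?_, fun e => ?_⟩
  · have := hx.1 t
    have := hy.1 t
    simp only [Pi.add_apply, Pi.smul_apply, smul_eq_mul]
    positivity
  · have h1 := mul_le_mul_of_nonneg_left (hx.2 e) ha.le
    have h2 := mul_lt_mul_of_pos_left (hy.2 e) hb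
    have h3 : a * (N.cap e : ℝ) + b * N.cap e = N.cap e := by rw [← add_mul, hab, one_mul]
    rw [Finset.mul_sum] at h1 h2
    rw [← h3]
    refine lt_of_eq_of_lt ?_ (add_lt_add_of_le_of_lt h1 h2)
    rw [← Finset.sum_add_distrib]
    refine Finset.sum_congr rfl fun t _ => ?_
    simp only [Pi.add_apply, Pi.smul_apply, smul_eq_mul]
    ring

theorem rateMap_mem_achievableRoutingRates [Finite V] [Finite A] (hN : N.Nondegenerate)
    {q : N.TreeIndex → ℚ} (hq : (fun t => (q t : ℝ)) ∈ N.strictPackings) :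
    N.rateMap (fun t => (q t : ℝ)) ∈ N.achievableRoutingRates := by
  classical
  obtain ⟨n, hn, z, hz⟩ := exists_common_denominator q
  have hn' : (0 : ℝ) < n := by exact_mod_cast hn
  have hzr : ∀ t, (q t : ℝ) = (z t : ℝ) / n := fun t => by rw [hz t]; push_cast; rfl
  have hzpos : ∀ t, 0 < z t := by
    intro t
    have : (0 : ℝ) < q t := hq.1 t
    rw [hzr t, div_pos_iff_of_pos_right hn'] at this
    exact_mod_cast this
  lift z to N.TreeIndex → ℕ using fun t => (hzpos t).le
  simp only [Int.cast_natCast, Int.natCast_pos] at hzr hzpos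
  have hpos : ∀ m, 0 < ∑ T : N.SteinerTree m, z ⟨m, T⟩ := by
    intro m
    obtain ⟨T, hT⟩ := hN.exists_steinerTree m
    exact Finset.sum_pos (fun T _ => hzpos ⟨m, T⟩) ⟨⟨T, hT⟩, Finset.mem_univ _⟩
  have := N.mem_achievableRoutingRates_of_multiplicities z hn hpos fun e => ?_
  · convert this using 1
    funext m
    change ∑ T : N.SteinerTree m, (q ⟨m, T⟩ : ℝ) = _
    simp only [hzr]
    rw [← Finset.sum_div]
    push_cast
    rfl
  · have := (hq.2 e).le
    simp only [hzr, ← mul_div_assoc] at this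
    rw [← Finset.sum_div, div_le_iff₀ hn', mul_comm (N.cap e : ℝ)] at this
    exact_mod_cast this

theorem routingRegion_eq_image [Finite V] [Finite A] (hN : N.Nondegenerate)
    (h : ∀ t : N.TreeIndex, t.2.1.Nonempty) :
    N.routingRegion = N.rateMap '' N.packingPolytope := by
  refine Set.Subset.antisymm ?_ ?_
  · refine closure_minimal ?_ ((isCompact_packingPolytope h).image continuous_rateMap).isClosed
    rintro _ ⟨F, _, _, c, -, hr, hs, rfl⟩
    exact c.rate_mem_image hr hs
  · have hd : DenseRange fun (q : N.TreeIndex → ℚ) t => (q t : ℝ) :=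
      DenseRange.piMap fun _ => Rat.denseRange_cast
    have h1 : N.packingPolytope ⊆
        closure (N.strictPackings ∩ Set.range fun (q : N.TreeIndex → ℚ) t => (q t : ℝ)) := by
      refine packingPolytope_subset_closure.trans (closure_minimal ?_ isClosed_closure)
      exact hd.open_subset_closure_inter isOpen_strictPackings
    refine (Set.image_mono h1).trans ((image_closure_subset_closure_image continuous_rateMap).trans
      (closure_mono ?_))
    rintro _ ⟨_, ⟨hx, q, rfl⟩, rfl⟩
    exact rateMap_mem_achievableRoutingRates hN hx

theorem convexHull_extremePoints_packingPolytope (h : ∀ t : N.TreeIndex, t.2.1.Nonempty) :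
    convexHull ℝ (N.packingPolytope.extremePoints ℝ) = N.packingPolytope := by
  have hfin : (N.packingPolytope.extremePoints ℝ).Finite := by
    rw [packingPolytope_eq_polyhedron]
    exact finite_extremePoints_polyhedron _ _
  rw [← (hfin.isClosed_convexHull (𝕜 := ℝ)).closure_eq]
  refine closure_convexHull_extremePoints (isCompact_packingPolytope h) ?_
  rw [packingPolytope_eq_polyhedron]
  exact convex_polyhedron _ _

theorem rateMap_image_eq_convexHull (h : ∀ t : N.TreeIndex, t.2.1.Nonempty) :
    N.rateMap '' N.packingPolytope =
      convexHull ℝ (N.rateMap '' N.packingPolytope.extremePoints ℝ) := by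
  rw [← N.rateMap.image_convexHull, convexHull_extremePoints_packingPolytope h]

theorem isRationalPoint_of_mem_extremePoints_packingPolytope {x : N.TreeIndex → ℝ}
    (hx : x ∈ N.packingPolytope.extremePoints ℝ) : IsRationalPoint x := by
  rw [packingPolytope_eq_polyhedron] at hx
  exact isRationalPoint_of_mem_extremePoints _ _ hx

theorem isRationalPoint_of_mem_extremePoints_image (h : ∀ t : N.TreeIndex, t.2.1.Nonempty)
    {y : M → ℝ} (hy : y ∈ (N.rateMap '' N.packingPolytope).extremePoints ℝ) :
    IsRationalPoint y := by
  rw [rateMap_image_eq_convexHull h] at hy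
  obtain ⟨x, hx, rfl⟩ := extremePoints_convexHull_subset hy
  choose q hq using isRationalPoint_of_mem_extremePoints_packingPolytope hx
  intro m
  refine ⟨∑ T : N.SteinerTree m, q ⟨m, T⟩, ?_⟩
  change ∑ T : N.SteinerTree m, x ⟨m, T⟩ = _
  push_cast
  exact Finset.sum_congr rfl fun T _ => hq _

theorem rateMap_apply_eq_sum [DecidableEq M] (x : N.TreeIndex → ℝ) (m : M) :
    N.rateMap x m = ∑ t : N.TreeIndex, (if t.1 = m then 1 else 0) * x t := by
  rw [Fintype.sum_sigma, Finset.sum_eq_single m]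
  · simp [rateMap]
  · intro m' _ hm
    simp [hm]
  · simp

theorem isBoundedRationalPolytope_image (h : ∀ t : N.TreeIndex, t.2.1.Nonempty) :
    IsBoundedRationalPolytope (N.rateMap '' N.packingPolytope) := by
  classical
  let φ := Fintype.equivFin N.TreeIndex
  obtain ⟨K, hK, B, b, hB⟩ := exists_polyhedron_eq_projection (ι := M) (Fintype.card N.TreeIndex)
    (J := (N.TreeIndex ⊕ E) ⊕ M ⊕ M)
    (Sum.elim (fun j k => N.packingRows j (φ.symm k))
      (Sum.elim (fun m k => if (φ.symm k).1 = m then 1 else 0)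
        (fun m k => if (φ.symm k).1 = m then -1 else 0)))
    (Sum.elim (fun _ _ => 0)
      (Sum.elim (fun m i => if i = m then -1 else 0) (fun m i => if i = m then 1 else 0)))
    (Sum.elim N.packingBounds (fun _ => 0))
  refine .of_polyhedron B b (hB ▸ ?_)
    ((isCompact_packingPolytope h).image continuous_rateMap).isBounded
  have hsum : ∀ (x : Fin (Fintype.card N.TreeIndex) → ℝ) (f : N.TreeIndex → ℝ),
      ∑ k, f (φ.symm k) * x k = ∑ t, f t * x (φ t) := by
    intro x f
    rw [← φ.sum_comp]
    simp
  ext y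
  have key : ∀ x : Fin (Fintype.card N.TreeIndex) → ℝ,
      ((fun t => x (φ t)) ∈ N.packingPolytope ∧ N.rateMap (fun t => x (φ t)) = y) ↔
        (∀ j, ∑ k, (N.packingRows j (φ.symm k) : ℝ) * x k ≤ N.packingBounds j) ∧
        (∀ m, ∑ k, (if (φ.symm k).1 = m then 1 else 0) * x k ≤ y m) ∧
        ∀ m, y m ≤ ∑ k, (if (φ.symm k).1 = m then 1 else 0) * x k := by
    intro x
    rw [packingPolytope_eq_polyhedron, funext_iff, ← forall_and]
    refine and_congr (forall_congr' fun j => ?_) (forall_congr' fun m => ?_)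
    · rw [hsum x fun t => (N.packingRows j t : ℝ)]
      rfl
    · rw [hsum x fun t => if t.1 = m then 1 else 0, ← rateMap_apply_eq_sum, le_antisymm_iff]
  trans ∃ x : Fin (Fintype.card N.TreeIndex) → ℝ,
    (fun t => x (φ t)) ∈ N.packingPolytope ∧ N.rateMap (fun t => x (φ t)) = y
  · constructor
    · rintro ⟨x, hx, hxy⟩
      refine ⟨fun k => x (φ.symm k), ?_⟩
      simpa using ⟨hx, hxy⟩
    · rintro ⟨x, hx, hxy⟩
      exact ⟨_, hx, hxy⟩
  · refine exists_congr fun x => (key x).trans ?_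
    refine Iff.trans ?_ (Sum.forall.trans (and_congr_right' Sum.forall)).symm
    refine and_congr (forall_congr' fun j => by simp) (and_congr (forall_congr' fun m => ?_)
      (forall_congr' fun m => ?_))
    · simp [apply_ite (Rat.cast : ℚ → ℝ), ite_mul]
    · have e : ∀ k, (if (φ.symm k).1 = m then -x k else 0) =
          -(if (φ.symm k).1 = m then x k else 0) := fun k => by split_ifs <;> simp
      simp only [Sum.elim_inr, apply_ite (Rat.cast : ℚ → ℝ), ite_mul, Rat.cast_one, Rat.cast_zero,
        Rat.cast_neg, one_mul, zero_mul, neg_mul, Finset.sum_ite_eq', Finset.mem_univ, if_true, e,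
        Finset.sum_neg_distrib]
      constructor <;> intro h <;> linarith

end Region

end Network

/-! ## Integral certificates for vertices -/

section Certificates

open Filter Topology

variable {ι J : Type*} [Fintype ι]

/-- A system of rows with natural coefficients has a nontrivial kernel vector or a left inverse,
given by natural numbers; the rows are selected by a mask `χ`. -/
theorem exists_nat_kernel_or_leftInverse [Fintype J] [DecidableEq ι] (r : J → ι → ℕ) (χ : J → ℕ)
    (hχ : ∀ j, χ j = 0 ∨ χ j = 1) :
    (∃ p p' : ι → ℕ, (∃ t, p t ≠ p' t) ∧
      ∀ j, χ j = 1 → ∑ t, r j t * p t = ∑ t, r j t * p' t) ∨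
    ∃ (q : ℕ) (Y Y' : ι → J → ℕ), 0 < q ∧ ∀ t s,
      ∑ j, χ j * Y t j * r j s = ∑ j, χ j * Y' t j * r j s + if t = s then q else 0 := by
  have hcast : ∀ z : ℤ, ((z.toNat : ℕ) : ℚ) - (((-z).toNat : ℕ) : ℚ) = z := by
    intro z
    have : ((z.toNat : ℕ) : ℤ) - (((-z).toNat : ℕ) : ℤ) = z := by omega
    exact_mod_cast congrArg (fun z : ℤ => (z : ℚ)) this
  rcases exists_kernel_or_leftInverse (fun j t => (r j t : ℚ)) {j | χ j = 1} with
    ⟨z, hz0, hz⟩ | ⟨Y, hY0, hY⟩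
  · left
    obtain ⟨n, hn, a, ha⟩ := exists_common_denominator z
    have hn' : (n : ℚ) ≠ 0 := by exact_mod_cast hn.ne'
    refine ⟨fun t => (a t).toNat, fun t => (-a t).toNat, ?_, fun j hj => ?_⟩
    · by_contra! h
      refine hz0 (funext fun t => ?_)
      have : a t = 0 := by have := h t; omega
      simp [ha t, this]
    · have h1 := hz j hj
      simp only [dotProduct, ha, ← mul_div_assoc] at h1
      rw [← Finset.sum_div, div_eq_zero_iff, or_iff_left hn'] at h1
      simp only [← hcast, mul_sub, Finset.sum_sub_distrib] at h1
      exact_mod_cast sub_eq_zero.1 h1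
  · right
    obtain ⟨n, hn, a, ha⟩ := exists_common_denominator fun p : ι × J => Y p.1 p.2
    have hn' : (n : ℚ) ≠ 0 := by exact_mod_cast hn.ne'
    refine ⟨n, fun t j => (a (t, j)).toNat, fun t j => (-a (t, j)).toNat, hn, fun t s => ?_⟩
    have h1 : ∑ j, (χ j : ℚ) * a (t, j) * r j s = if t = s then (n : ℚ) else 0 := by
      have h2 : ∀ j, (χ j : ℚ) * a (t, j) * r j s = n * (Y t j * r j s) := by
        intro j
        rw [ha (t, j)]
        rcases hχ j with h | h
        · have := hY0 t j (by simp [h])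
          rw [ha (t, j), div_eq_zero_iff, or_iff_left hn'] at this
          simp [this]
        · rw [h]
          field_simp
          simp
      simp only [h2, ← Finset.mul_sum, hY]
      simp
    simp only [← hcast, mul_sub, sub_mul, Finset.sum_sub_distrib] at h1
    have h3 := eq_add_of_sub_eq' h1
    split_ifs at h3 ⊢ <;> exact_mod_cast h3

/-- The effect of a left inverse with natural coefficients. -/
theorem mul_eq_of_nat_leftInverse [Fintype J] [DecidableEq ι] {r : J → ι → ℕ} {χ : J → ℕ} {q : ℕ}
    {Y Y' : ι → J → ℕ} (hY : ∀ t s,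
      ∑ j, χ j * Y t j * r j s = ∑ j, χ j * Y' t j * r j s + if t = s then q else 0)
    (z : ι → ℝ) (t : ι) :
    (q : ℝ) * z t = ∑ j, (χ j : ℝ) * Y t j * ∑ s, (r j s : ℝ) * z s -
      ∑ j, (χ j : ℝ) * Y' t j * ∑ s, (r j s : ℝ) * z s := by
  have h : ∀ s, (∑ j, (χ j : ℝ) * Y t j * r j s) - ∑ j, (χ j : ℝ) * Y' t j * r j s =
      if t = s then (q : ℝ) else 0 := by
    intro s
    rw [sub_eq_iff_eq_add']
    have := congrArg (fun n : ℕ => (n : ℝ)) (hY t s)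
    push_cast at this
    exact this
  simp only [Finset.mul_sum, ← mul_assoc]
  rw [Finset.sum_comm, Finset.sum_comm (f := fun j s => (χ j : ℝ) * Y' t j * r j s * z s)]
  simp only [← Finset.sum_mul, ← Finset.sum_sub_distrib, ← sub_mul, h]
  simp

/-! ### Convex combinations of finitely many rational points -/

omit [Fintype ι] in
theorem exists_real_weights {K : Type*} [Fintype K] {w : K → ι → ℝ} {x : ι → ℝ}
    (hx : x ∈ convexHull ℝ (Set.range w)) :
    ∃ ν : K → ℝ, (∀ k, 0 ≤ ν k) ∧ ∑ k, ν k = 1 ∧ ∀ i, ∑ k, ν k * w k i = x i := by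
  classical
  let f : (K → ℝ) →ₗ[ℝ] (ι → ℝ) := Fintype.linearCombination ℝ w
  have : convexHull ℝ (Set.range w) ⊆ f '' stdSimplex ℝ K := by
    refine convexHull_min ?_ ((convex_stdSimplex ℝ K).linear_image f)
    rintro _ ⟨k, rfl⟩
    exact ⟨Pi.single k 1, single_mem_stdSimplex ℝ k, by simp [f]⟩
  obtain ⟨ν, hν, rfl⟩ := this hx
  refine ⟨ν, hν.1, hν.2, fun i => ?_⟩
  simp [f, Fintype.linearCombination_apply, Finset.sum_apply]

theorem exists_rat_weights {K : Type*} [Fintype K] {w : K → ι → ℚ} {x : ι → ℚ}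
    (hx : (fun i => (x i : ℝ)) ∈ convexHull ℝ (Set.range fun k i => (w k i : ℝ))) :
    ∃ ν : K → ℚ, (∀ k, 0 ≤ ν k) ∧ ∑ k, ν k = 1 ∧ ∀ i, ∑ k, ν k * w k i = x i := by
  classical
  let G : Option ι → K → ℚ := fun o k => o.elim 1 (w k)
  let g : Option ι → ℚ := fun o => o.elim 1 x
  let B : K ⊕ Option ι ⊕ Option ι → K → ℚ :=
    Sum.elim (fun k => -Pi.single k 1) (Sum.elim G (fun o => -G o))
  let b : K ⊕ Option ι ⊕ Option ι → ℚ := Sum.elim (fun _ => 0) (Sum.elim g (fun o => -g o))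
  let P : Set (K → ℝ) := polyhedron (fun j i => (B j i : ℝ)) (fun j => (b j : ℝ))
  have hP : ∀ ν : K → ℝ, ν ∈ P ↔ (∀ k, 0 ≤ ν k) ∧ ∑ k, ν k = 1 ∧
      ∀ i, ∑ k, ν k * w k i = x i := by
    intro ν
    have h1 : ∀ k, (fun i => (B (Sum.inl k) i : ℝ)) ⬝ᵥ ν = -ν k := by
      intro k
      simp [B, dotProduct, Pi.single_apply, apply_ite (Rat.cast : ℚ → ℝ), ite_mul]
    have h2 : ∀ o, (fun i => (B (Sum.inr (Sum.inl o)) i : ℝ)) ⬝ᵥ ν = ∑ k, (G o k : ℝ) * ν k :=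
      fun o => rfl
    have h3 : ∀ o, (fun i => (B (Sum.inr (Sum.inr o)) i : ℝ)) ⬝ᵥ ν = -∑ k, (G o k : ℝ) * ν k := by
      intro o
      simp [B, dotProduct]
    have h4 : ν ∈ P ↔ (∀ k, 0 ≤ ν k) ∧ ∀ o, ∑ k, (G o k : ℝ) * ν k = g o := by
      simp only [P, polyhedron, Set.mem_ofPred_eq, Sum.forall, h1, h2, h3, ← forall_and]
      refine and_congr (forall_congr' fun k => by simp [b]) (forall_congr' fun o => ?_)
      simp only [b, Sum.elim_inl, Sum.elim_inr, Rat.cast_neg, neg_le_neg_iff]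
      exact le_antisymm_iff.symm
    rw [h4, Option.forall]
    simp [G, g, mul_comm]
  obtain ⟨ν, hν⟩ := exists_real_weights hx
  have hcpt : IsCompact P := by
    refine (isCompact_stdSimplex ℝ K).of_isClosed_subset (isClosed_polyhedron _ _) ?_
    intro ν hν
    exact ⟨((hP ν).1 hν).1, ((hP ν).1 hν).2.1⟩
  obtain ⟨ν', hν'⟩ := hcpt.extremePoints_nonempty ⟨ν, (hP ν).2 hν⟩
  choose q hq using isRationalPoint_of_mem_extremePoints B b hν'
  obtain ⟨h0, h1, h2⟩ := (hP ν').1 hν'.1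
  simp only [hq] at h0 h1 h2
  exact ⟨q, fun k => by exact_mod_cast h0 k, by exact_mod_cast h1, fun i => by exact_mod_cast h2 i⟩

theorem exists_int_functional {K : Type*} [Fintype K] {w : K → ι → ℝ} {x : ι → ℝ}
    (hx : x ∉ convexHull ℝ (Set.range w)) :
    ∃ a : ι → ℤ, ∀ k, ∑ i, (a i : ℝ) * w k i < ∑ i, (a i : ℝ) * x i := by
  classical
  obtain ⟨f, u, hf, hu⟩ := geometric_hahn_banach_closed_point (convex_convexHull ℝ (Set.range w))
    ((Set.finite_range w).isClosed_convexHull (𝕜 := ℝ)) hx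
  have hfs : ∀ y : ι → ℝ, f y = ∑ i, f (Pi.single i 1) * y i := by
    intro y
    conv_lhs => rw [← Finset.univ_sum_single y]
    rw [map_sum]
    refine Finset.sum_congr rfl fun i _ => ?_
    rw [mul_comm, ← smul_eq_mul, ← map_smul]
    congr 1
    ext j
    simp [Pi.single_apply]
  let U : Set (ι → ℝ) := ⋂ k, {a | ∑ i, a i * w k i < ∑ i, a i * x i}
  have hU : IsOpen U := isOpen_iInter_of_finite fun k => isOpen_lt (by fun_prop) (by fun_prop)
  have hne : U.Nonempty := by
    refine ⟨fun i => f (Pi.single i 1), Set.mem_iInter.2 fun k => ?_⟩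
    change ∑ i, f (Pi.single i 1) * w k i < ∑ i, f (Pi.single i 1) * x i
    rw [← hfs, ← hfs]
    exact (hf _ (subset_convexHull ℝ _ ⟨k, rfl⟩)).trans hu
  have hd : DenseRange fun (q : ι → ℚ) t => (q t : ℝ) := DenseRange.piMap fun _ => Rat.denseRange_cast
  obtain ⟨q, hq⟩ := hd.exists_mem_open hU hne
  obtain ⟨n, hn, a, ha⟩ := exists_common_denominator q
  have hn' : (0 : ℝ) < n := by exact_mod_cast hn
  refine ⟨a, fun k => ?_⟩
  have h1 : ∑ i, (q i : ℝ) * w k i < ∑ i, (q i : ℝ) * x i := Set.mem_iInter.1 hq k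
  have h2 : ∀ y : ι → ℝ, ∑ i, (q i : ℝ) * y i = (∑ i, (a i : ℝ) * y i) / n := by
    intro y
    rw [Finset.sum_div]
    refine Finset.sum_congr rfl fun i _ => ?_
    rw [ha i]
    push_cast
    ring
  rw [h2, h2, div_lt_div_iff_of_pos_right hn'] at h1
  exact h1

/-- A unique maximizer of a linear functional among the points is an extreme point of their convex
hull. -/
theorem mem_extremePoints_of_functional {K : Type*} {w : K → ι → ℝ} {k : K} (a : ι → ℝ)
    (ha : ∀ l, w l ≠ w k → ∑ i, a i * w l i < ∑ i, a i * w k i) :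
    w k ∈ (convexHull ℝ (Set.range w)).extremePoints ℝ := by
  have hsub : convexHull ℝ (Set.range w) ⊆ {y | y = w k ∨ a ⬝ᵥ y < a ⬝ᵥ w k} := by
    refine convexHull_min ?_ ?_
    · rintro _ ⟨l, rfl⟩
      by_cases h : w l = w k
      · exact Or.inl h
      · exact Or.inr (ha l h)
    · intro x hx y hy s t hs ht hst
      have hle : ∀ z, z ∈ {y | y = w k ∨ a ⬝ᵥ y < a ⬝ᵥ w k} → a ⬝ᵥ z ≤ a ⬝ᵥ w k := by
        rintro z (rfl | h)
        · exact le_rfl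
        · exact h.le
      have e : a ⬝ᵥ w k = s * (a ⬝ᵥ w k) + t * (a ⬝ᵥ w k) := by rw [← add_mul, hst, one_mul]
      have h1 := mul_le_mul_of_nonneg_left (hle x hx) hs
      have h2 := mul_le_mul_of_nonneg_left (hle y hy) ht
      rcases hs.eq_or_lt with rfl | hs
      · rw [zero_add] at hst
        simpa [hst] using hy
      rcases ht.eq_or_lt with rfl | ht
      · rw [add_zero] at hst
        simpa [hst] using hx
      rcases hx with rfl | hx
      · rcases hy with rfl | hy
        · left
          rw [← add_smul, hst, one_smul]
        · right
          have := mul_lt_mul_of_pos_left hy ht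
          rw [dotProduct_add, dotProduct_smul, dotProduct_smul, smul_eq_mul, smul_eq_mul]
          linarith
      · right
        have := mul_lt_mul_of_pos_left hx hs
        rw [dotProduct_add, dotProduct_smul, dotProduct_smul, smul_eq_mul, smul_eq_mul]
        linarith
  rw [mem_extremePoints]
  refine ⟨subset_convexHull ℝ _ ⟨k, rfl⟩, fun x hx y hy ⟨s, t, hs, ht, hst, hxy⟩ => ?_⟩
  have e : a ⬝ᵥ w k = s * (a ⬝ᵥ x) + t * (a ⬝ᵥ y) := by
    rw [← hxy, dotProduct_add, dotProduct_smul, dotProduct_smul, smul_eq_mul, smul_eq_mul]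
  have e' : a ⬝ᵥ w k = s * (a ⬝ᵥ w k) + t * (a ⬝ᵥ w k) := by rw [← add_mul, hst, one_mul]
  rcases hsub hx with h1 | h1 <;> rcases hsub hy with h2 | h2
  · exact ⟨h1, h2⟩
  · have := mul_lt_mul_of_pos_left h2 ht
    rw [h1] at e
    linarith
  · have := mul_lt_mul_of_pos_left h1 hs
    rw [h2] at e
    linarith
  · have := mul_lt_mul_of_pos_left h1 hs
    have := mul_lt_mul_of_pos_left h2 ht
    linarith

omit [Fintype ι] in
theorem notMem_extremePoints_of_mem_convexHull {S : Set (ι → ℝ)} {x : ι → ℝ}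
    (hx : x ∈ convexHull ℝ (S \ {x})) : x ∉ (convexHull ℝ S).extremePoints ℝ := by
  intro h
  rw [Convex.mem_extremePoints_iff_mem_sdiff_convexHull_sdiff (convex_convexHull ℝ S)] at h
  refine h.2 (convexHull_mono ?_ hx)
  intro y hy
  exact ⟨subset_convexHull ℝ S hy.1, hy.2⟩

end Certificates

/-! ## Primitive recursive predicates and functions -/

attribute [fun_prop] Primrec PrimrecPred
attribute [fun_prop] Primrec.id Primrec.const Primrec.comp Primrec.fst Primrec.snd Primrec.pair
attribute [fun_prop] Primrec.list_length Primrec.list_range PrimrecPred.and PrimrecPred.or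
attribute [fun_prop] PrimrecPred.not PrimrecPred.comp

/-- Bounded universal quantification. -/
def ForallLT (n : ℕ) (p : ℕ → Prop) : Prop := ∀ i < n, p i

/-- Bounded existential quantification. -/
def ExistsLT (n : ℕ) (p : ℕ → Prop) : Prop := ∃ i < n, p i

/-- Existential quantification over the members of a list. -/
def ExistsMem {β : Type*} (L : List β) (p : β → Prop) : Prop := ∃ b ∈ L, p b

section PrimrecRules

variable {α β γ : Type*} [Primcodable α] [Primcodable β] [Primcodable γ]

@[fun_prop]
theorem PrimrecPred.lt_of_primrec {f g : α → ℕ} (hf : Primrec f) (hg : Primrec g) :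
    PrimrecPred fun a => f a < g a :=
  Primrec.nat_lt.comp hf hg

@[fun_prop]
theorem PrimrecPred.le_of_primrec {f g : α → ℕ} (hf : Primrec f) (hg : Primrec g) :
    PrimrecPred fun a => f a ≤ g a :=
  Primrec.nat_le.comp hf hg

@[fun_prop]
theorem PrimrecPred.eq_of_primrec {f g : α → β} (hf : Primrec f) (hg : Primrec g) :
    PrimrecPred fun a => f a = g a :=
  Primrec.eq.comp hf hg

@[fun_prop]
theorem PrimrecPred.forallLT {n : α → ℕ} {p : α → ℕ → Prop} (hn : Primrec n)
    (hp : PrimrecPred fun q : α × ℕ => p q.1 q.2) :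
    PrimrecPred fun a => ForallLT (n a) fun i => p a i :=
  ((PrimrecRel.forall_mem_list (R := fun i a => p a i)
    (hp.comp (f := fun q : ℕ × α => (q.2, q.1)) (by fun_prop))).comp
      (Primrec.list_range.comp hn) Primrec.id).of_eq fun a => by simp [ForallLT]

@[fun_prop]
theorem PrimrecPred.existsLT {n : α → ℕ} {p : α → ℕ → Prop} (hn : Primrec n)
    (hp : PrimrecPred fun q : α × ℕ => p q.1 q.2) :
    PrimrecPred fun a => ExistsLT (n a) fun i => p a i :=
  ((PrimrecRel.exists_mem_list (R := fun i a => p a i)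
    (hp.comp (f := fun q : ℕ × α => (q.2, q.1)) (by fun_prop))).comp
      (Primrec.list_range.comp hn) Primrec.id).of_eq fun a => by simp [ExistsLT]

@[fun_prop]
theorem PrimrecPred.existsMem {L : α → List β} {p : α → β → Prop} (hL : Primrec L)
    (hp : PrimrecPred fun q : α × β => p q.1 q.2) :
    PrimrecPred fun a => ExistsMem (L a) fun b => p a b :=
  (PrimrecRel.exists_mem_list (R := fun b a => p a b)
    (hp.comp (f := fun q : β × α => (q.2, q.1)) (by fun_prop))).comp hL Primrec.id

namespace Primrec

@[fun_prop]
theorem add_fun {f g : α → ℕ} (hf : Primrec f) (hg : Primrec g) : Primrec fun a => f a + g a :=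
  nat_add.comp hf hg

@[fun_prop]
theorem sub_fun {f g : α → ℕ} (hf : Primrec f) (hg : Primrec g) : Primrec fun a => f a - g a :=
  nat_sub.comp hf hg

@[fun_prop]
theorem mul_fun {f g : α → ℕ} (hf : Primrec f) (hg : Primrec g) : Primrec fun a => f a * g a :=
  nat_mul.comp hf hg

@[fun_prop]
theorem div_fun {f g : α → ℕ} (hf : Primrec f) (hg : Primrec g) : Primrec fun a => f a / g a :=
  nat_div.comp hf hg

@[fun_prop]
theorem mod_fun {f g : α → ℕ} (hf : Primrec f) (hg : Primrec g) : Primrec fun a => f a % g a :=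
  nat_mod.comp hf hg

@[fun_prop]
theorem pow_fun {f g : α → ℕ} (hf : Primrec f) (hg : Primrec g) : Primrec fun a => f a ^ g a :=
  (Primrec₂.unpaired'.1 Nat.Primrec.pow).comp hf hg

@[fun_prop]
theorem beq_fun [DecidableEq β] {f g : α → β} (hf : Primrec f) (hg : Primrec g) :
    Primrec fun a => f a == g a :=
  Primrec.beq.comp hf hg

@[fun_prop]
theorem ite_fun {p : α → Prop} [DecidablePred p] {f g : α → β} (hp : PrimrecPred p)
    (hf : Primrec f) (hg : Primrec g) : Primrec fun a => if p a then f a else g a :=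
  Primrec.ite hp hf hg

@[fun_prop]
theorem getD_fun {f : α → List β} {g : α → ℕ} {d : β} (hf : Primrec f) (hg : Primrec g) :
    Primrec fun a => (f a).getD (g a) d :=
  (Primrec.list_getD d).comp hf hg

@[fun_prop]
theorem map_fun {f : α → List β} {g : α → β → γ} (hf : Primrec f)
    (hg : Primrec fun p : α × β => g p.1 p.2) : Primrec fun a => (f a).map fun b => g a b :=
  Primrec.list_map hf hg

open Classical in
@[fun_prop]
theorem filter_fun {f : α → List β} {p : α → β → Prop} (hf : Primrec f)
    (hp : PrimrecPred fun q : α × β => p q.1 q.2) :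
    Primrec fun a => (f a).filter fun b => decide (p a b) :=
  (PrimrecRel.listFilter (R := fun b a => p a b)
    (hp.comp (f := fun q : β × α => (q.2, q.1)) (by fun_prop))).comp hf Primrec.id

@[fun_prop]
theorem sum_range_fun {f : α → ℕ → ℕ} {n : α → ℕ} (hn : Primrec n)
    (hf : Primrec fun p : α × ℕ => f p.1 p.2) :
    Primrec fun a => ∑ i ∈ Finset.range (n a), f a i := by
  have := Primrec.nat_rec' hn (Primrec.const 0) (h := fun a p => p.2 + f a p.1)
    (nat_add.comp (snd.comp snd) (hf.comp (fst.pair (fst.comp snd))))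
  refine this.of_eq fun a => ?_
  induction n a with
  | zero => simp
  | succ n ih => simp [Finset.sum_range_succ, ih]

end Primrec

/-- A total primitive recursive relation has a computable choice function. -/
theorem exists_computable_selector {R : α → β → Prop} (hR : PrimrecPred fun p : α × β => R p.1 p.2)
    (h : ∀ a, ∃ b, R a b) : ∃ f : α → β, Computable f ∧ ∀ a, R a (f a) := by
  classical
  let F : α → ℕ → Option β := fun a n => (Encodable.decode (α := β) n).bind
    fun b => if R a b then some b else none
  have hF : Primrec₂ F := by
    refine Primrec.option_bind (Primrec.decode.comp Primrec.snd) ?_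
    have h1 : PrimrecPred fun q : (α × ℕ) × β => R q.1.1 q.2 :=
      hR.comp (f := fun q : (α × ℕ) × β => (q.1.1, q.2)) (by fun_prop)
    exact Primrec.ite h1 (Primrec.option_some.comp Primrec.snd) (Primrec.const none)
  have hdom : ∀ a, (Nat.rfindOpt (F a)).Dom := by
    intro a
    obtain ⟨b, hb⟩ := h a
    exact Nat.rfindOpt_dom.2 ⟨Encodable.encode b, b, by simp [F, hb]⟩
  refine ⟨fun a => (Nat.rfindOpt (F a)).get (hdom a),
    (Partrec.rfindOpt hF.to_comp).of_eq_tot fun a => Part.get_mem _, fun a => ?_⟩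
  obtain ⟨n, hn⟩ := Nat.rfindOpt_spec (Part.get_mem (hdom a))
  simp only [F, Option.mem_def, Option.bind_eq_some_iff] at hn
  obtain ⟨b, -, hb⟩ := hn
  split_ifs at hb with hRb
  have e : b = (Nat.rfindOpt (F a)).get (hdom a) := Option.some_injective _ hb
  rw [e] at hRb
  exact hRb

end PrimrecRules

/-! ## Combinatorial data of network descriptions -/

namespace NetworkCode

/-- The `i`-th binary digit. -/
def bit (T i : ℕ) : ℕ := T / 2 ^ i % 2

def edgeNum (c : NetworkCode) : ℕ := c.2.2.2.1.length

def msgNum (c : NetworkCode) : ℕ := c.2.1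

def tail (c : NetworkCode) (i : ℕ) : ℕ := (c.2.2.2.1.getD i (0, 0, 0)).1

def head (c : NetworkCode) (i : ℕ) : ℕ := (c.2.2.2.1.getD i (0, 0, 0)).2.1

def cap (c : NetworkCode) (i : ℕ) : ℕ := (c.2.2.2.1.getD i (0, 0, 0)).2.2

def IsSource (c : NetworkCode) (x m : ℕ) : Prop := (c.2.2.2.2.1.getD x []).getD m false = true

def IsReceiver (c : NetworkCode) (x m : ℕ) : Prop := (c.2.2.2.2.2.getD x []).getD m false = true

def Serves (c : NetworkCode) (m T v : ℕ) : Prop :=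
  c.IsSource v m ∨ ExistsLT c.edgeNum fun i => bit T i = 1 ∧ c.head i = v

/-- The binary digits of `T` select the edges of a Steiner tree for `m`. -/
def IsSteinerTree (c : NetworkCode) (m T : ℕ) : Prop :=
  (ForallLT c.edgeNum fun i => ¬ bit T i = 1 ∨ c.Serves m T (c.tail i)) ∧
  (ForallLT c.edgeNum fun i => ForallLT c.edgeNum fun j =>
    ¬ (bit T i = 1 ∧ bit T j = 1 ∧ c.head i = c.head j) ∨ i = j) ∧
  ForallLT c.1 fun x => ¬ c.IsReceiver x m ∨ c.Serves m T x

open Classical in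
/-- The list of all pairs of a message and a Steiner tree, coded by numbers. -/
noncomputable def trees (c : NetworkCode) : List ℕ :=
  (List.range (c.msgNum * 2 ^ c.edgeNum)).filter
    fun j => c.IsSteinerTree (j / 2 ^ c.edgeNum) (j % 2 ^ c.edgeNum)

noncomputable def dim (c : NetworkCode) : ℕ := c.trees.length

/-- The message of the `t`-th tree. -/
noncomputable def msg (c : NetworkCode) (t : ℕ) : ℕ := c.trees.getD t 0 / 2 ^ c.edgeNum

/-- The incidence of the edge `e` with the `t`-th tree. -/
noncomputable def inc (c : NetworkCode) (e t : ℕ) : ℕ := bit (c.trees.getD t 0 % 2 ^ c.edgeNum) e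

/-- The rows of the inequality system of the packing polytope, up to sign. -/
noncomputable def row (c : NetworkCode) (j t : ℕ) : ℕ :=
  if j < c.dim then (if j = t then 1 else 0) else c.inc (j - c.dim) t

/-- The right-hand sides of the inequality system of the packing polytope. -/
noncomputable def rhs (c : NetworkCode) (j : ℕ) : ℕ :=
  if j < c.dim then 0 else c.cap (j - c.dim)

noncomputable def rowNum (c : NetworkCode) : ℕ := c.dim + c.edgeNum

/-- Certificates: a set of rows, coded by a number; the positive part, the negative part and the
denominator of a left inverse; two vectors with the same image. -/
abbrev VertexCert : Type := ℕ × List (List ℕ) × List (List ℕ) × ℕ × List ℕ × List ℕ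

/-- An entry of the product of a matrix, restricted to the columns in `I`, with a vector. -/
noncomputable def maskedSum (c : NetworkCode) (I : ℕ) (Y : List (List ℕ)) (t : ℕ) (g : ℕ → ℕ) : ℕ :=
  ∑ j ∈ Finset.range c.rowNum, bit I j * (Y.getD t []).getD j 0 * g j

/-- The selected rows have a nontrivial kernel. -/
def IsKernelCert (c : NetworkCode) (w : VertexCert) : Prop :=
  (ExistsLT c.dim fun t => ¬ w.2.2.2.2.1.getD t 0 = w.2.2.2.2.2.getD t 0) ∧
  ForallLT c.rowNum fun j => ¬ bit w.1 j = 1 ∨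
    ∑ t ∈ Finset.range c.dim, c.row j t * w.2.2.2.2.1.getD t 0 =
      ∑ t ∈ Finset.range c.dim, c.row j t * w.2.2.2.2.2.getD t 0

/-- The selected rows have a left inverse. -/
def IsInverseCert (c : NetworkCode) (w : VertexCert) : Prop :=
  0 < w.2.2.2.1 ∧ ForallLT c.dim fun t => ForallLT c.dim fun s =>
    c.maskedSum w.1 w.2.1 t (fun j => c.row j s) =
      c.maskedSum w.1 w.2.2.1 t (fun j => c.row j s) + if t = s then w.2.2.2.1 else 0

/-- The numerators of the point at which the selected rows are tight. -/
noncomputable def num (c : NetworkCode) (w : VertexCert) (t : ℕ) : ℕ :=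
  c.maskedSum w.1 w.2.1 t c.rhs - c.maskedSum w.1 w.2.2.1 t c.rhs

/-- The point satisfies all inequalities, and the selected rows are tight. -/
def IsFeasible (c : NetworkCode) (w : VertexCert) : Prop :=
  (ForallLT c.edgeNum fun e =>
    ∑ t ∈ Finset.range c.dim, c.inc e t * c.num w t ≤ w.2.2.2.1 * c.cap e) ∧
  ForallLT c.rowNum fun j => ¬ bit w.1 j = 1 ∨
    ∑ t ∈ Finset.range c.dim, c.row j t * c.num w t = w.2.2.2.1 * c.rhs j

/-- There is a certificate for every set of rows. -/
def Covers (c : NetworkCode) (C : List VertexCert) : Prop :=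
  ForallLT (2 ^ c.rowNum) fun I => ExistsMem C fun w =>
    w.1 = I ∧ (c.IsKernelCert w ∨ c.IsInverseCert w)

def IsVertexCert (c : NetworkCode) (w : VertexCert) : Prop :=
  c.IsInverseCert w ∧ c.IsFeasible w

open Classical in
noncomputable def vertexCerts (c : NetworkCode) (C : List VertexCert) : List VertexCert :=
  C.filter fun w => c.IsVertexCert w

noncomputable def packingCode (c : NetworkCode) (w : VertexCert) : PackingCode :=
  (List.range c.dim).map fun t =>
    ((c.msg t, (List.range c.edgeNum).map fun e => c.inc e t == 1), (c.num w t, w.2.2.2.1))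

/-- The rate vector of a packing: the numerators and the common denominator. -/
noncomputable def rateCode (c : NetworkCode) (w : VertexCert) : List ℕ × ℕ :=
  ((List.range c.msgNum).map fun k =>
    ∑ t ∈ Finset.range c.dim, if c.msg t = k then c.num w t else 0, w.2.2.2.1)

section PrimrecData

variable {α : Type*} [Primcodable α]

@[fun_prop]
theorem primrec_bit {f g : α → ℕ} (hf : Primrec f) (hg : Primrec g) :
    Primrec fun a => bit (f a) (g a) := by
  unfold bit; fun_prop

@[fun_prop]
theorem primrec_edgeNum : Primrec edgeNum := by
  unfold edgeNum; fun_prop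

@[fun_prop]
theorem primrec_msgNum : Primrec msgNum := by
  unfold msgNum; fun_prop

@[fun_prop]
theorem primrec_tail {c : α → NetworkCode} {i : α → ℕ} (hc : Primrec c) (hi : Primrec i) :
    Primrec fun a => tail (c a) (i a) := by
  unfold tail; fun_prop

@[fun_prop]
theorem primrec_head {c : α → NetworkCode} {i : α → ℕ} (hc : Primrec c) (hi : Primrec i) :
    Primrec fun a => head (c a) (i a) := by
  unfold head; fun_prop

@[fun_prop]
theorem primrec_cap {c : α → NetworkCode} {i : α → ℕ} (hc : Primrec c) (hi : Primrec i) :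
    Primrec fun a => cap (c a) (i a) := by
  unfold cap; fun_prop

@[fun_prop]
theorem primrecPred_isSource {c : α → NetworkCode} {x m : α → ℕ} (hc : Primrec c) (hx : Primrec x)
    (hm : Primrec m) : PrimrecPred fun a => IsSource (c a) (x a) (m a) := by
  unfold IsSource; fun_prop

@[fun_prop]
theorem primrecPred_isReceiver {c : α → NetworkCode} {x m : α → ℕ} (hc : Primrec c)
    (hx : Primrec x) (hm : Primrec m) : PrimrecPred fun a => IsReceiver (c a) (x a) (m a) := by
  unfold IsReceiver; fun_prop

@[fun_prop]
theorem primrecPred_serves {c : α → NetworkCode} {m T v : α → ℕ} (hc : Primrec c)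
    (hm : Primrec m) (hT : Primrec T) (hv : Primrec v) :
    PrimrecPred fun a => Serves (c a) (m a) (T a) (v a) := by
  unfold Serves; fun_prop

@[fun_prop]
theorem primrecPred_isSteinerTree {c : α → NetworkCode} {m T : α → ℕ} (hc : Primrec c)
    (hm : Primrec m) (hT : Primrec T) :
    PrimrecPred fun a => IsSteinerTree (c a) (m a) (T a) := by
  unfold IsSteinerTree; fun_prop

@[fun_prop]
theorem primrec_trees : Primrec trees := by
  unfold trees; fun_prop

@[fun_prop]
theorem primrec_dim : Primrec dim := by
  unfold dim; fun_prop

@[fun_prop]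
theorem primrec_msg {c : α → NetworkCode} {t : α → ℕ} (hc : Primrec c) (ht : Primrec t) :
    Primrec fun a => msg (c a) (t a) := by
  unfold msg; fun_prop

@[fun_prop]
theorem primrec_inc {c : α → NetworkCode} {e t : α → ℕ} (hc : Primrec c) (he : Primrec e)
    (ht : Primrec t) : Primrec fun a => inc (c a) (e a) (t a) := by
  unfold inc; fun_prop

@[fun_prop]
theorem primrec_row {c : α → NetworkCode} {j t : α → ℕ} (hc : Primrec c) (hj : Primrec j)
    (ht : Primrec t) : Primrec fun a => row (c a) (j a) (t a) := by
  unfold row; fun_prop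

@[fun_prop]
theorem primrec_rhs {c : α → NetworkCode} {j : α → ℕ} (hc : Primrec c) (hj : Primrec j) :
    Primrec fun a => rhs (c a) (j a) := by
  unfold rhs; fun_prop

@[fun_prop]
theorem primrec_rowNum : Primrec rowNum := by
  unfold rowNum; fun_prop

@[fun_prop]
theorem primrec_maskedSum {c : α → NetworkCode} {I t : α → ℕ} {Y : α → List (List ℕ)}
    {g : α → ℕ → ℕ} (hc : Primrec c) (hI : Primrec I) (hY : Primrec Y) (ht : Primrec t)
    (hg : Primrec fun p : α × ℕ => g p.1 p.2) :
    Primrec fun a => maskedSum (c a) (I a) (Y a) (t a) (fun j => g a j) := by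
  unfold maskedSum; fun_prop

@[fun_prop]
theorem primrecPred_isKernelCert {c : α → NetworkCode} {w : α → VertexCert} (hc : Primrec c)
    (hw : Primrec w) : PrimrecPred fun a => IsKernelCert (c a) (w a) := by
  unfold IsKernelCert; fun_prop

@[fun_prop]
theorem primrecPred_isInverseCert {c : α → NetworkCode} {w : α → VertexCert} (hc : Primrec c)
    (hw : Primrec w) : PrimrecPred fun a => IsInverseCert (c a) (w a) := by
  unfold IsInverseCert; fun_prop

@[fun_prop]
theorem primrec_num {c : α → NetworkCode} {w : α → VertexCert} {t : α → ℕ} (hc : Primrec c)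
    (hw : Primrec w) (ht : Primrec t) : Primrec fun a => num (c a) (w a) (t a) := by
  unfold num; fun_prop

@[fun_prop]
theorem primrecPred_isFeasible {c : α → NetworkCode} {w : α → VertexCert} (hc : Primrec c)
    (hw : Primrec w) : PrimrecPred fun a => IsFeasible (c a) (w a) := by
  unfold IsFeasible; fun_prop

@[fun_prop]
theorem primrecPred_covers {c : α → NetworkCode} {C : α → List VertexCert} (hc : Primrec c)
    (hC : Primrec C) : PrimrecPred fun a => Covers (c a) (C a) := by
  unfold Covers; fun_prop

@[fun_prop]
theorem primrecPred_isVertexCert {c : α → NetworkCode} {w : α → VertexCert} (hc : Primrec c)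
    (hw : Primrec w) : PrimrecPred fun a => IsVertexCert (c a) (w a) := by
  unfold IsVertexCert; fun_prop

@[fun_prop]
theorem primrec_vertexCerts {c : α → NetworkCode} {C : α → List VertexCert} (hc : Primrec c)
    (hC : Primrec C) : Primrec fun a => vertexCerts (c a) (C a) := by
  unfold vertexCerts; fun_prop

@[fun_prop]
theorem primrec_packingCode {c : α → NetworkCode} {w : α → VertexCert} (hc : Primrec c)
    (hw : Primrec w) : Primrec fun a => packingCode (c a) (w a) := by
  unfold packingCode; fun_prop

@[fun_prop]
theorem primrec_rateCode {c : α → NetworkCode} {w : α → VertexCert} (hc : Primrec c)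
    (hw : Primrec w) : Primrec fun a => rateCode (c a) (w a) := by
  unfold rateCode; fun_prop

end PrimrecData

end NetworkCode

namespace NetworkCode

/-! ## Correctness of the vertex certificates -/

theorem bit_eq_zero_or_one (T i : ℕ) : bit T i = 0 ∨ bit T i = 1 :=
  Nat.mod_two_eq_zero_or_one _

theorem bit_eq_one_iff (T i : ℕ) : bit T i = 1 ↔ T.testBit i = true := by
  rw [Nat.testBit_eq_decide_div_mod_eq, decide_eq_true_iff, bit]

theorem exists_bits {n : ℕ} (p : ℕ → Prop) : ∃ T < 2 ^ n, ∀ i < n, bit T i = 1 ↔ p i := by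
  classical
  refine ⟨Nat.ofBits fun i : Fin n => decide (p i), Nat.ofBits_lt_two_pow _, fun i hi => ?_⟩
  rw [bit_eq_one_iff, Nat.testBit_ofBits_lt _ _ hi]
  simp

theorem eq_of_bit_eq_one_iff {n T T' : ℕ} (hT : T < 2 ^ n) (hT' : T' < 2 ^ n)
    (h : ∀ i < n, bit T i = 1 ↔ bit T' i = 1) : T = T' := by
  refine Nat.eq_of_testBit_eq fun i => ?_
  by_cases hi : i < n
  · have := h i hi
    rw [bit_eq_one_iff, bit_eq_one_iff] at this
    exact Bool.eq_iff_iff.2 this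
  · have hle := Nat.pow_le_pow_right (n := 2) (by norm_num) (not_lt.1 hi)
    rw [Nat.testBit_lt_two_pow (hT.trans_le hle), Nat.testBit_lt_two_pow (hT'.trans_le hle)]

theorem getD_ofFn {α : Type*} {n : ℕ} (f : Fin n → α) (d : α) (i : Fin n) :
    (List.ofFn f).getD i d = f i := by
  simp [List.getD_eq_getElem?_getD]

variable (c : NetworkCode)

/-- The polytope that belongs to a network description. -/
def feasibleSet : Set (Fin c.dim → ℝ) :=
  {x | (∀ t, 0 ≤ x t) ∧ ∀ e < c.edgeNum, ∑ t : Fin c.dim, (c.inc e t : ℝ) * x t ≤ c.cap e}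

theorem sum_row_of_lt (x : Fin c.dim → ℝ) (j : Fin c.dim) :
    ∑ t : Fin c.dim, (c.row j t : ℝ) * x t = x j := by
  simp [row, ← Fin.ext_iff]

theorem row_add (e t : ℕ) : c.row (c.dim + e) t = c.inc e t := by
  simp [row]

theorem rhs_of_lt (j : Fin c.dim) : c.rhs j = 0 := by
  simp [rhs]

theorem rhs_add (e : ℕ) : c.rhs (c.dim + e) = c.cap e := by
  simp [rhs]

theorem forall_rowNum_iff {p : ℕ → Prop} :
    (∀ j : Fin c.rowNum, p j) ↔ (∀ t : Fin c.dim, p t) ∧ ∀ e < c.edgeNum, p (c.dim + e) := by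
  constructor
  · intro h
    exact ⟨fun t => h ⟨t, by have := t.2; unfold rowNum; omega⟩,
      fun e he => h ⟨c.dim + e, by unfold rowNum; omega⟩⟩
  · rintro ⟨h1, h2⟩ ⟨j, hj⟩
    by_cases hjd : j < c.dim
    · exact h1 ⟨j, hjd⟩
    · have := h2 (j - c.dim) (by unfold rowNum at hj; omega)
      rwa [Nat.add_sub_cancel' (not_lt.1 hjd)] at this

theorem mem_extremePoints_feasibleSet_iff (x : Fin c.dim → ℝ) :
    x ∈ c.feasibleSet.extremePoints ℝ ↔ x ∈ c.feasibleSet ∧ ∀ z : Fin c.dim → ℝ,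
      (∀ j : Fin c.rowNum, ∑ t : Fin c.dim, (c.row j t : ℝ) * x t = c.rhs j →
        ∑ t : Fin c.dim, (c.row j t : ℝ) * z t = 0) → z = 0 := by
  let σ : ℕ → ℝ := fun j => if j < c.dim then -1 else 1
  have hσ : ∀ j, σ j ≠ 0 := by
    intro j
    simp only [σ]
    split_ifs <;> norm_num
  have hdot : ∀ (j : Fin c.rowNum) (y : Fin c.dim → ℝ),
      (fun t : Fin c.dim => σ j * c.row j t) ⬝ᵥ y = σ j * ∑ t : Fin c.dim, (c.row j t : ℝ) * y t := by
    intro j y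
    simp [dotProduct, Finset.mul_sum, mul_assoc]
  have hset : c.feasibleSet =
      polyhedron (fun (j : Fin c.rowNum) (t : Fin c.dim) => σ j * c.row j t) fun j => σ j * c.rhs j := by
    ext y
    simp only [polyhedron, Set.mem_ofPred_eq, hdot]
    rw [c.forall_rowNum_iff
      (p := fun j => σ j * ∑ t : Fin c.dim, (c.row j t : ℝ) * y t ≤ σ j * c.rhs j)]
    simp only [sum_row_of_lt, rhs_of_lt, row_add, rhs_add]
    simp [feasibleSet, σ]
  rw [hset, mem_extremePoints_polyhedron_iff]
  refine and_congr_right fun _ => forall_congr' fun z => imp_congr (forall_congr' fun j => ?_) Iff.rfl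
  rw [hdot, hdot, mul_right_inj' (hσ j), mul_eq_zero, or_iff_right (hσ j)]

variable {c}

theorem IsInverseCert.sum_eq {w : VertexCert} (hw : c.IsInverseCert w) (t s : Fin c.dim) :
    ∑ j : Fin c.rowNum, bit w.1 j * (w.2.1.getD t []).getD j 0 * c.row j s =
      ∑ j : Fin c.rowNum, bit w.1 j * (w.2.2.1.getD t []).getD j 0 * c.row j s +
        if t = s then w.2.2.2.1 else 0 := by
  have := hw.2 t t.2 s s.2
  simp only [maskedSum, Finset.sum_range, ← Fin.ext_iff] at this
  exact this

theorem IsInverseCert.eq_zero {w : VertexCert} (hw : c.IsInverseCert w) {z : Fin c.dim → ℝ}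
    (hz : ∀ j : Fin c.rowNum, bit w.1 j = 1 → ∑ t : Fin c.dim, (c.row j t : ℝ) * z t = 0) :
    z = 0 := by
  have hq : (w.2.2.2.1 : ℝ) ≠ 0 := by exact_mod_cast hw.1.ne'
  funext t
  refine (mul_eq_zero.1 ((mul_eq_of_nat_leftInverse hw.sum_eq z t).trans ?_)).resolve_left hq
  rw [Finset.sum_eq_zero, Finset.sum_eq_zero, sub_zero] <;>
  · intro j _
    rcases bit_eq_zero_or_one w.1 j with h | h
    · simp [h]
    · rw [hz j h, mul_zero]

theorem IsVertexCert.mem_extremePoints {w : VertexCert} (hw : c.IsVertexCert w) :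
    (fun t : Fin c.dim => (c.num w t : ℝ) / w.2.2.2.1) ∈ c.feasibleSet.extremePoints ℝ := by
  obtain ⟨hinv, hfeas⟩ := hw
  have hq : (0 : ℝ) < w.2.2.2.1 := by exact_mod_cast hinv.1
  rw [mem_extremePoints_feasibleSet_iff]
  refine ⟨⟨fun t => by positivity, fun e he => ?_⟩, fun z hz => hinv.eq_zero fun j hj => hz j ?_⟩
  · have := hfeas.1 e he
    beta_reduce at this
    rw [Finset.sum_range] at this
    simp only [← mul_div_assoc]
    rw [← Finset.sum_div, div_le_iff₀ hq, mul_comm]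
    exact_mod_cast this
  · have := (hfeas.2 j j.2).resolve_left (not_not.2 hj)
    rw [Finset.sum_range] at this
    simp only [← mul_div_assoc]
    rw [← Finset.sum_div, div_eq_iff hq.ne', mul_comm]
    exact_mod_cast this

theorem IsInverseCert.num_eq {w : VertexCert} (hw : c.IsInverseCert w) {x : Fin c.dim → ℝ}
    (h0 : ∀ t, 0 ≤ x t)
    (hx : ∀ j : Fin c.rowNum, bit w.1 j = 1 → ∑ t : Fin c.dim, (c.row j t : ℝ) * x t = c.rhs j)
    (t : Fin c.dim) : (c.num w t : ℝ) = w.2.2.2.1 * x t := by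
  have hs : ∀ Y : List (List ℕ), ∑ j : Fin c.rowNum, (bit w.1 j : ℝ) *
      ((Y.getD t []).getD j 0 : ℕ) * ∑ s : Fin c.dim, (c.row j s : ℝ) * x s =
      (c.maskedSum w.1 Y t c.rhs : ℝ) := by
    intro Y
    rw [maskedSum, Finset.sum_range, Nat.cast_sum]
    refine Finset.sum_congr rfl fun j _ => ?_
    rcases bit_eq_zero_or_one w.1 j with h | h
    · simp [h]
    · rw [hx j h]
      push_cast
      rfl
  have h1 := mul_eq_of_nat_leftInverse hw.sum_eq x t
  rw [hs, hs] at h1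
  have h2 : 0 ≤ (w.2.2.2.1 : ℝ) * x t := mul_nonneg (Nat.cast_nonneg _) (h0 t)
  rw [h1] at h2 ⊢
  rw [num, Nat.cast_sub (by exact_mod_cast sub_nonneg.1 h2)]

theorem mem_vertexCerts {C : List VertexCert} {w : VertexCert} :
    w ∈ c.vertexCerts C ↔ w ∈ C ∧ c.IsVertexCert w := by
  classical
  simp [vertexCerts]

theorem Covers.exists_vertexCert {C : List VertexCert} (hC : c.Covers C) {x : Fin c.dim → ℝ}
    (hx : x ∈ c.feasibleSet.extremePoints ℝ) :
    ∃ w ∈ c.vertexCerts C, ∀ t : Fin c.dim, x t = (c.num w t : ℝ) / w.2.2.2.1 := by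
  rw [mem_extremePoints_feasibleSet_iff] at hx
  obtain ⟨⟨h0, hcap⟩, hker⟩ := hx
  obtain ⟨I, hI, htight⟩ := exists_bits (n := c.rowNum)
    fun j => ∑ t : Fin c.dim, (c.row j t : ℝ) * x t = c.rhs j
  obtain ⟨w, hwC, rfl, hw⟩ := hC I hI
  have hinv : c.IsInverseCert w := by
    refine hw.resolve_left fun ⟨⟨t, ht, hne⟩, heq⟩ => hne ?_
    have := hker (fun t => (w.2.2.2.2.1.getD t 0 : ℝ) - w.2.2.2.2.2.getD t 0) fun j hj => ?_
    · have := congrFun this ⟨t, ht⟩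
      exact_mod_cast sub_eq_zero.1 this
    · have h := (heq j j.2).resolve_left (not_not.2 ((htight j j.2).2 hj))
      rw [Finset.sum_range, Finset.sum_range] at h
      simp only [mul_sub, Finset.sum_sub_distrib]
      rw [sub_eq_zero]
      exact_mod_cast h
  have hq : (0 : ℝ) < w.2.2.2.1 := by exact_mod_cast hinv.1
  have hnum := hinv.num_eq h0 fun j hj => (htight j j.2).1 hj
  have hsum : ∀ r : ℕ → ℕ, ((∑ t ∈ Finset.range c.dim, r t * c.num w t : ℕ) : ℝ) =
      w.2.2.2.1 * ∑ t : Fin c.dim, (r t : ℝ) * x t := by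
    intro r
    rw [Finset.sum_range, Finset.mul_sum]
    push_cast
    refine Finset.sum_congr rfl fun t _ => ?_
    rw [hnum t]
    ring
  refine ⟨w, ?_, fun t => by rw [hnum t, mul_div_cancel_left₀ _ hq.ne']⟩
  refine mem_vertexCerts.2 ⟨hwC, hinv, fun e he => ?_, fun j hj => not_or_of_imp fun hb => ?_⟩
  · beta_reduce
    rw [← Nat.cast_le (α := ℝ), hsum, Nat.cast_mul]
    exact mul_le_mul_of_nonneg_left (hcap e he) hq.le
  · rw [← Nat.cast_inj (R := ℝ), hsum, Nat.cast_mul, (htight j hj).1 hb]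

variable (c) in
theorem exists_covers : ∃ C, c.Covers C := by
  have h : ∀ I, ∃ w : VertexCert, w.1 = I ∧ (c.IsKernelCert w ∨ c.IsInverseCert w) := by
    intro I
    rcases exists_nat_kernel_or_leftInverse (fun (j : Fin c.rowNum) (t : Fin c.dim) => c.row j t)
      (fun j => bit I j) (fun j => bit_eq_zero_or_one I j) with
      ⟨p, p', ⟨t, ht⟩, h⟩ | ⟨q, Y, Y', hq, h⟩
    · refine ⟨(I, [], [], 0, List.ofFn p, List.ofFn p'), rfl, Or.inl ⟨⟨t, t.2, ?_⟩, fun j hj =>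
        not_or_of_imp fun hb => ?_⟩⟩
      · simpa only [getD_ofFn] using ht
      · have := h ⟨j, hj⟩ hb
        simpa only [Finset.sum_range, getD_ofFn] using this
    · refine ⟨(I, List.ofFn fun t => List.ofFn (Y t), List.ofFn fun t => List.ofFn (Y' t), q, [], []),
        rfl, Or.inr ⟨hq, fun t ht s hs => ?_⟩⟩
      have := h ⟨t, ht⟩ ⟨s, hs⟩
      simp only [maskedSum, Finset.sum_range, Fin.mk.injEq] at this ⊢
      have e : ∀ Z : Fin c.dim → Fin c.rowNum → ℕ, ∀ j : Fin c.rowNum,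
          ((List.ofFn fun t => List.ofFn (Z t)).getD t []).getD j 0 = Z ⟨t, ht⟩ j := by
        intro Z j
        rw [getD_ofFn (fun t => List.ofFn (Z t)) [] ⟨t, ht⟩, getD_ofFn]
      simp only [e]
      exact this
  choose f hf using h
  refine ⟨(List.range (2 ^ c.rowNum)).map f, fun I hI => ⟨f I, ?_, hf I⟩⟩
  exact List.mem_map.2 ⟨I, List.mem_range.2 hI, rfl⟩

end NetworkCode

/-! ## Computing the vertices of the convex hull of finitely many points -/

/-- Descriptions of finite sets of nonnegative rational points: the dimension and the list of the
points, each given by its numerators and the common denominator. -/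
abbrev PointsCode : Type := ℕ × List (List ℕ × ℕ)

namespace PointsCode

def size (p : PointsCode) : ℕ := p.2.length

def num (p : PointsCode) (i k : ℕ) : ℕ := (p.2.getD i ([], 0)).1.getD k 0

def den (p : PointsCode) (i : ℕ) : ℕ := (p.2.getD i ([], 0)).2

/-- The `i`-th and the `j`-th point coincide. -/
def Same (p : PointsCode) (i j : ℕ) : Prop :=
  ForallLT p.1 fun k => p.num i k * p.den j = p.num j k * p.den i

/-- Certificates: the positive part and the negative part of a linear functional; weights. -/
abbrev HullCert : Type := List ℕ × List ℕ × List ℕ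

/-- The `i`-th point is the unique maximizer of the functional. -/
def IsFunctionalCert (p : PointsCode) (i : ℕ) (w : HullCert) : Prop :=
  ForallLT p.size fun j => p.Same i j ∨
    ∑ k ∈ Finset.range p.1,
      (w.1.getD k 0 * (p.num j k * p.den i) + w.2.1.getD k 0 * (p.num i k * p.den j)) <
    ∑ k ∈ Finset.range p.1,
      (w.1.getD k 0 * (p.num i k * p.den j) + w.2.1.getD k 0 * (p.num j k * p.den i))

/-- The `i`-th point is a convex combination of the other points. -/
def IsWeightCert (p : PointsCode) (i : ℕ) (w : HullCert) : Prop :=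
  (ExistsLT p.size fun j => 0 < w.2.2.getD j 0) ∧
  (ForallLT p.size fun j => ¬ p.Same i j ∨ w.2.2.getD j 0 = 0) ∧
  ForallLT p.1 fun k => ∑ j ∈ Finset.range p.size, w.2.2.getD j 0 * (p.num j k * p.den i) =
    ∑ j ∈ Finset.range p.size, w.2.2.getD j 0 * (p.num i k * p.den j)

/-- The certificates decide for every point whether it is a vertex. The denominators of
descriptions are positive. -/
def Decides (p : PointsCode) (D : List HullCert) : Prop :=
  (ExistsLT p.size fun i => p.den i = 0) ∨
  ForallLT p.size fun i => p.IsFunctionalCert i (D.getD i ([], [], [])) ∨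
    p.IsWeightCert i (D.getD i ([], [], []))

open Classical in
noncomputable def vertices (p : PointsCode) (D : List HullCert) : List VectorCode :=
  ((List.range p.size).filter fun i => p.IsFunctionalCert i (D.getD i ([], [], []))).map
    fun i => (List.range p.1).map fun k => (p.num i k, p.den i)

section PrimrecData

variable {α : Type*} [Primcodable α]

@[fun_prop]
theorem primrec_size : Primrec size := by
  unfold size; fun_prop

@[fun_prop]
theorem primrec_num {p : α → PointsCode} {i k : α → ℕ} (hp : Primrec p) (hi : Primrec i)
    (hk : Primrec k) : Primrec fun a => num (p a) (i a) (k a) := by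
  unfold num; fun_prop

@[fun_prop]
theorem primrec_den {p : α → PointsCode} {i : α → ℕ} (hp : Primrec p) (hi : Primrec i) :
    Primrec fun a => den (p a) (i a) := by
  unfold den; fun_prop

@[fun_prop]
theorem primrecPred_same {p : α → PointsCode} {i j : α → ℕ} (hp : Primrec p) (hi : Primrec i)
    (hj : Primrec j) : PrimrecPred fun a => Same (p a) (i a) (j a) := by
  unfold Same; fun_prop

@[fun_prop]
theorem primrecPred_isFunctionalCert {p : α → PointsCode} {i : α → ℕ} {w : α → HullCert}
    (hp : Primrec p) (hi : Primrec i) (hw : Primrec w) :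
    PrimrecPred fun a => IsFunctionalCert (p a) (i a) (w a) := by
  unfold IsFunctionalCert; fun_prop

@[fun_prop]
theorem primrecPred_isWeightCert {p : α → PointsCode} {i : α → ℕ} {w : α → HullCert}
    (hp : Primrec p) (hi : Primrec i) (hw : Primrec w) :
    PrimrecPred fun a => IsWeightCert (p a) (i a) (w a) := by
  unfold IsWeightCert; fun_prop

@[fun_prop]
theorem primrecPred_decides {p : α → PointsCode} {D : α → List HullCert} (hp : Primrec p)
    (hD : Primrec D) : PrimrecPred fun a => Decides (p a) (D a) := by
  unfold Decides; fun_prop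

@[fun_prop]
theorem primrec_vertices {p : α → PointsCode} {D : α → List HullCert} (hp : Primrec p)
    (hD : Primrec D) : Primrec fun a => vertices (p a) (D a) := by
  unfold vertices; fun_prop

end PrimrecData

/-! ### Correctness -/

variable {p : PointsCode}

/-- The `i`-th point. -/
noncomputable def point (p : PointsCode) (i : Fin p.size) (k : Fin p.1) : ℝ :=
  (p.num i k : ℝ) / p.den i

theorem same_iff (hp : ∀ i < p.size, p.den i ≠ 0) (i j : Fin p.size) :
    p.Same i j ↔ p.point j = p.point i := by
  have hi : (p.den i : ℝ) ≠ 0 := by exact_mod_cast hp i i.2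
  have hj : (p.den j : ℝ) ≠ 0 := by exact_mod_cast hp j j.2
  rw [funext_iff]
  constructor
  · intro h k
    rw [point, point, div_eq_div_iff hj hi]
    exact_mod_cast (h k k.2).symm
  · intro h k hk
    have := h ⟨k, hk⟩
    rw [point, point, div_eq_div_iff hj hi] at this
    exact_mod_cast this.symm

theorem sum_functional (hp : ∀ i < p.size, p.den i ≠ 0) (i j : Fin p.size) (a b : ℕ → ℕ) :
    ∑ k ∈ Finset.range p.1, (a k * (p.num j k * p.den i) + b k * (p.num i k * p.den j)) <
      ∑ k ∈ Finset.range p.1, (a k * (p.num i k * p.den j) + b k * (p.num j k * p.den i)) ↔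
    ∑ k : Fin p.1, ((a k : ℝ) - b k) * p.point j k < ∑ k : Fin p.1, ((a k : ℝ) - b k) * p.point i k := by
  have hi : (0 : ℝ) < p.den i := by exact_mod_cast Nat.pos_of_ne_zero (hp i i.2)
  have hj : (0 : ℝ) < p.den j := by exact_mod_cast Nat.pos_of_ne_zero (hp j j.2)
  rw [Finset.sum_range, Finset.sum_range, ← Nat.cast_lt (α := ℝ), ← sub_pos,
    ← sub_pos (b := ∑ k : Fin p.1, ((a k : ℝ) - b k) * p.point j k)]
  rw [← mul_pos_iff_of_pos_left (mul_pos hi hj)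
    (b := ∑ k : Fin p.1, ((a k : ℝ) - b k) * p.point i k - _)]
  have : ∀ x y : ℝ, x = y → (0 < x ↔ 0 < y) := by rintro x _ rfl; rfl
  apply this
  push_cast
  rw [← Finset.sum_sub_distrib, ← Finset.sum_sub_distrib, Finset.mul_sum]
  refine Finset.sum_congr rfl fun k _ => ?_
  rw [point, point]
  field_simp
  ring

theorem IsFunctionalCert.mem_extremePoints (hp : ∀ i < p.size, p.den i ≠ 0) {i : Fin p.size}
    {w : HullCert} (hw : p.IsFunctionalCert i w) :
    p.point i ∈ (convexHull ℝ (Set.range p.point)).extremePoints ℝ := by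
  refine mem_extremePoints_of_functional
    (fun k => (w.1.getD k 0 : ℝ) - w.2.1.getD k 0) fun j hj => ?_
  have := (hw j j.2).resolve_left fun h => hj ((same_iff hp i j).1 h)
  exact (sum_functional hp i j (fun k => w.1.getD k 0) (fun k => w.2.1.getD k 0)).1 this

theorem IsWeightCert.notMem_extremePoints (hp : ∀ i < p.size, p.den i ≠ 0) {i : Fin p.size}
    {w : HullCert} (hw : p.IsWeightCert i w) :
    p.point i ∉ (convexHull ℝ (Set.range p.point)).extremePoints ℝ := by
  obtain ⟨⟨l, hl, hpos⟩, hsame, heq⟩ := hw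
  refine notMem_extremePoints_of_mem_convexHull ?_
  let ν : Fin p.size → ℝ := fun j => (w.2.2.getD j 0 : ℝ) * p.den j
  have hden : ∀ j : Fin p.size, (0 : ℝ) < p.den j :=
    fun j => by exact_mod_cast Nat.pos_of_ne_zero (hp j j.2)
  have hν : ∀ j, 0 ≤ ν j := fun j => by positivity
  have hsum : 0 < ∑ j, ν j := by
    refine Finset.sum_pos' (fun j _ => hν j) ⟨⟨l, hl⟩, Finset.mem_univ _, ?_⟩
    exact mul_pos (by exact_mod_cast hpos) (hden ⟨l, hl⟩)
  have hz : Finset.univ.centerMass ν p.point = p.point i := by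
    rw [Finset.centerMass, inv_smul_eq_iff₀ hsum.ne']
    ext k
    have h := heq k k.2
    beta_reduce at h
    rw [Finset.sum_range, Finset.sum_range] at h
    have h' := congrArg (fun n : ℕ => (n : ℝ)) h
    push_cast at h'
    simp only [Finset.sum_apply, Pi.smul_apply, smul_eq_mul, Finset.sum_mul]
    rw [← mul_left_inj' (hden i).ne', Finset.sum_mul, Finset.sum_mul]
    calc _ = ∑ j : Fin p.size, (w.2.2.getD j 0 : ℝ) * (p.num j k * p.den i) := by
          refine Finset.sum_congr rfl fun j _ => ?_
          have := (hden j).ne'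
          simp only [ν, point]
          field_simp
      _ = ∑ j : Fin p.size, (w.2.2.getD j 0 : ℝ) * (p.num i k * p.den j) := h'
      _ = _ := by
          refine Finset.sum_congr rfl fun j _ => ?_
          have := (hden i).ne'
          simp only [ν, point]
          field_simp
  have hsub : ∀ s : Finset (Fin p.size), (∀ j ∉ s, ν j = 0) →
      Finset.univ.centerMass ν p.point = s.centerMass ν p.point := by
    intro s hs
    exact (Finset.centerMass_subset p.point s.subset_univ fun j _ hj => hs j hj).symm
  classical
  have hs : ∀ j ∉ Finset.univ.filter (fun j => p.point j ≠ p.point i), ν j = 0 := by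
    intro j hj
    simp only [Finset.mem_filter, Finset.mem_univ, true_and, not_not] at hj
    have := (hsame j j.2).resolve_left (not_not.2 ((same_iff hp i j).2 hj))
    simp only [ν]
    rw [this]
    simp
  have hmem := Finset.centerMass_mem_convexHull (R := ℝ) (s := Set.range p.point \ {p.point i})
    (Finset.univ.filter fun j => p.point j ≠ p.point i) (w := ν) (z := p.point)
    (fun j _ => hν j) (by rwa [Finset.sum_subset (Finset.subset_univ _) fun j _ hj => hs j hj])
    fun j hj => ⟨⟨j, rfl⟩, (Finset.mem_filter.1 hj).2⟩
  rwa [← hsub _ hs, hz] at hmem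

theorem exists_hullCert (hp : ∀ i < p.size, p.den i ≠ 0) (i : Fin p.size) :
    ∃ w, p.IsFunctionalCert i w ∨ p.IsWeightCert i w := by
  classical
  have hden : ∀ j : Fin p.size, (p.den j : ℚ) ≠ 0 := fun j => by exact_mod_cast hp j j.2
  let K := {j : Fin p.size // p.point j ≠ p.point i}
  let W : Fin p.size → Fin p.1 → ℚ := fun j k => (p.num j k : ℚ) / p.den j
  have hW : ∀ j, (fun k => (W j k : ℝ)) = p.point j := by
    intro j
    funext k
    simp [W, point]
  by_cases hx : p.point i ∈ convexHull ℝ (Set.range fun j : K => p.point j)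
  · obtain ⟨ν, hν0, hν1, hν⟩ := exists_rat_weights (w := fun j : K => W j) (x := W i)
      (by
        have e : (fun (j : K) k => (W j k : ℝ)) = fun j : K => p.point j := funext fun j => hW j
        rw [hW i, e]
        exact hx)
    let μ : Fin p.size → ℚ := fun j => if h : p.point j ≠ p.point i then ν ⟨j, h⟩ / p.den j else 0
    have hμK : ∀ j : K, μ j * p.den j = ν j := by
      intro j
      have : μ j = ν j / p.den j := dif_pos j.2
      rw [this, div_mul_cancel₀ _ (hden j)]
    have hμ0 : ∀ j, p.point j = p.point i → μ j = 0 := fun j h => dif_neg (not_not.2 h)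
    have hμnn : ∀ j, 0 ≤ μ j := by
      intro j
      by_cases h : p.point j = p.point i
      · rw [hμ0 j h]
      · have : μ j = ν ⟨j, h⟩ / p.den j := dif_pos h
        rw [this]
        exact div_nonneg (hν0 _) (Nat.cast_nonneg _)
    have hsumK : ∀ f : Fin p.size → ℚ, ∑ j, μ j * p.den j * f j = ∑ j : K, ν j * f j := by
      intro f
      rw [← Finset.sum_filter_add_sum_filter_not Finset.univ (fun j => p.point j ≠ p.point i),
        Finset.sum_subtype (p := fun j => p.point j ≠ p.point i) _ (by simp),
        Finset.sum_eq_zero (s := Finset.univ.filter fun j => ¬ p.point j ≠ p.point i), add_zero]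
      · exact Finset.sum_congr rfl fun j _ => by rw [hμK j]
      · intro j hj
        rw [hμ0 j (by simpa using hj), zero_mul, zero_mul]
    obtain ⟨n, hn, z, hz⟩ := exists_common_denominator μ
    have hn' : (0 : ℚ) < n := by exact_mod_cast hn
    have hznn : ∀ j, 0 ≤ z j := by
      intro j
      have h1 : (z j : ℚ) = μ j * n := by rw [hz j, div_mul_cancel₀ _ hn'.ne']
      have h2 : (0 : ℚ) ≤ z j := h1 ▸ mul_nonneg (hμnn j) hn'.le
      exact_mod_cast h2
    lift z to Fin p.size → ℕ using hznn
    simp only [Int.cast_natCast] at hz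
    have hzμ : ∀ j, (z j : ℚ) = n * μ j := fun j => by rw [hz j, mul_div_cancel₀ _ hn'.ne']
    refine ⟨([], [], List.ofFn z), Or.inr ⟨?_, fun j hj => ?_, fun k hk => ?_⟩⟩
    · by_contra hcon
      have hall : ∀ j, z j = 0 := by
        intro j
        by_contra h
        exact hcon ⟨j, j.2, by beta_reduce; rw [NetworkCode.getD_ofFn]; exact Nat.pos_of_ne_zero h⟩
      have := hsumK fun _ => 1
      simp only [mul_one, hν1] at this
      rw [Finset.sum_eq_zero] at this
      · exact zero_ne_one this
      · intro j _
        rw [hz j, hall j]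
        simp
    · refine not_or_of_imp fun h => ?_
      rw [NetworkCode.getD_ofFn z 0 ⟨j, hj⟩]
      have := hzμ ⟨j, hj⟩
      rw [hμ0 ⟨j, hj⟩ ((same_iff hp i ⟨j, hj⟩).1 h), mul_zero] at this
      exact_mod_cast this
    · simp only [Finset.sum_range, NetworkCode.getD_ofFn]
      have h1 := hν ⟨k, hk⟩
      have h2 : ∑ j, μ j * p.den j * W j ⟨k, hk⟩ = W i ⟨k, hk⟩ * ∑ j, μ j * p.den j * 1 := by
        rw [hsumK, hsumK, h1]
        simp [hν1]
      have h3 : ∑ j : Fin p.size, (z j : ℚ) * (p.num j k * p.den i) =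
          n * p.den i * ∑ j, μ j * p.den j * W j ⟨k, hk⟩ := by
        rw [Finset.mul_sum]
        refine Finset.sum_congr rfl fun j _ => ?_
        have := hden j
        simp only [W, hzμ]
        field_simp
      have h4 : ∑ j : Fin p.size, (z j : ℚ) * (p.num i k * p.den j) =
          n * p.den i * (W i ⟨k, hk⟩ * ∑ j, μ j * p.den j * 1) := by
        rw [Finset.mul_sum, Finset.mul_sum]
        refine Finset.sum_congr rfl fun j _ => ?_
        have := hden i
        simp only [W, hzμ]
        field_simp
      have h5 := h3.trans ((congrArg _ h2).trans h4.symm)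
      exact_mod_cast h5
  · obtain ⟨a, ha⟩ := exists_int_functional hx
    refine ⟨(List.ofFn fun k => (a k).toNat, List.ofFn fun k => (-a k).toNat, []),
      Or.inl fun j hj => ?_⟩
    by_cases h : p.point ⟨j, hj⟩ = p.point i
    · exact Or.inl ((same_iff hp i ⟨j, hj⟩).2 h)
    · refine Or.inr ((sum_functional hp i ⟨j, hj⟩
        (fun k => (List.ofFn fun k => (a k).toNat).getD k 0)
        (fun k => (List.ofFn fun k => (-a k).toNat).getD k 0)).2 ?_)
      have e : ∀ k : Fin p.1, (((a k).toNat : ℕ) : ℝ) - (((-a k).toNat : ℕ) : ℝ) = a k := by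
        intro k
        have : (((a k).toNat : ℕ) : ℤ) - (((-a k).toNat : ℕ) : ℤ) = a k := by omega
        exact_mod_cast congrArg (fun z : ℤ => (z : ℝ)) this
      simp only [NetworkCode.getD_ofFn, e]
      exact ha ⟨⟨j, hj⟩, h⟩

theorem exists_decides (p : PointsCode) : ∃ D, p.Decides D := by
  by_cases hp : ∀ i < p.size, p.den i ≠ 0
  · choose f hf using exists_hullCert hp
    refine ⟨List.ofFn f, Or.inr fun i hi => ?_⟩
    beta_reduce
    rw [NetworkCode.getD_ofFn f _ ⟨i, hi⟩]
    exact hf ⟨i, hi⟩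
  · push Not at hp
    exact ⟨[], Or.inl hp⟩

theorem Decides.listsPoints {D : List HullCert} (hD : p.Decides D)
    (hp : ∀ i < p.size, p.den i ≠ 0) :
    ListsPoints VectorDescribes (p.vertices D)
      ((convexHull ℝ (Set.range p.point)).extremePoints ℝ) := by
  classical
  have hdesc : ∀ i : Fin p.size, VectorDescribes
      ((List.range p.1).map fun k => (p.num i k, p.den i)) (p.point i) := by
    intro i
    rw [VectorDescribes, List.forall₂_iff_get]
    refine ⟨by simp, fun k hk hk' => ?_⟩
    simp [FracDescribes, point, Nat.pos_of_ne_zero (hp i i.2)]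
  have hD' := hD.resolve_left fun ⟨i, hi, h⟩ => hp i hi h
  have hmem : ∀ L, L ∈ p.vertices D ↔ ∃ i : Fin p.size,
      p.IsFunctionalCert i (D.getD i ([], [], [])) ∧
      ((List.range p.1).map fun k => (p.num i k, p.den i)) = L := by
    intro L
    simp only [vertices, List.mem_map, List.mem_filter, List.mem_range, decide_eq_true_iff]
    constructor
    · rintro ⟨i, ⟨hi, hc⟩, rfl⟩
      exact ⟨⟨i, hi⟩, hc, rfl⟩
    · rintro ⟨i, hc, rfl⟩
      exact ⟨i, ⟨i.2, hc⟩, rfl⟩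
  constructor
  · intro L hL
    obtain ⟨i, hc, rfl⟩ := (hmem L).1 hL
    exact ⟨p.point i, hc.mem_extremePoints hp, hdesc i⟩
  · intro x hx
    obtain ⟨i, rfl⟩ := extremePoints_convexHull_subset hx
    refine ⟨_, (hmem _).2 ⟨i, ?_, rfl⟩, hdesc i⟩
    exact (hD' i i.2).resolve_right fun h => h.notMem_extremePoints hp hx

end PointsCode

namespace Network

open NetworkCode

/-! ## The polytope of the description of a network -/

section Code

variable {v e m a : ℕ} (N : Network (Fin v) (Fin e) (Fin m) (Fin a))

theorem edgeNum_code : N.code.edgeNum = e := by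
  simp [code, edgeNum]

theorem tail_code (i : Fin e) : N.code.tail i = N.tail i := by
  rw [NetworkCode.tail, code, getD_ofFn]

theorem head_code (i : Fin e) : N.code.head i = N.head i := by
  rw [NetworkCode.head, code, getD_ofFn]

theorem cap_code (i : Fin e) : N.code.cap i = N.cap i := by
  rw [NetworkCode.cap, code, getD_ofFn]

theorem isSource_code (x : Fin v) (k : Fin m) : N.code.IsSource x k ↔ k ∈ N.sources x := by
  rw [IsSource, code, getD_ofFn, getD_ofFn, decide_eq_true_iff]

theorem isReceiver_code (x : Fin v) (k : Fin m) : N.code.IsReceiver x k ↔ k ∈ N.receivers x := by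
  rw [IsReceiver, code, getD_ofFn, getD_ofFn, decide_eq_true_iff]

/-- The set of edges that is coded by the binary digits of a number. -/
def edgesOfBits (e T : ℕ) : Finset (Fin e) :=
  Finset.univ.filter fun i => bit T i = 1

theorem mem_edgesOfBits {e T : ℕ} {i : Fin e} : i ∈ edgesOfBits e T ↔ bit T i = 1 := by
  simp [edgesOfBits]

theorem serves_code (k : Fin m) (T : ℕ) (x : Fin v) :
    N.code.Serves k T x ↔ N.Serves k (edgesOfBits e T) x := by
  rw [NetworkCode.Serves, Network.Serves, isSource_code, edgeNum_code]
  refine or_congr_right ⟨?_, ?_⟩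
  · rintro ⟨i, hi, hT, hh⟩
    refine ⟨⟨i, hi⟩, mem_edgesOfBits.2 hT, Fin.ext ?_⟩
    rw [← hh, ← head_code]
  · rintro ⟨i, hT, rfl⟩
    exact ⟨i, i.2, mem_edgesOfBits.1 hT, N.head_code i⟩

theorem isSteinerTree_code (k : Fin m) (T : ℕ) :
    N.code.IsSteinerTree k T ↔ N.IsSteinerTree k (edgesOfBits e T) := by
  rw [isSteinerTree_iff, NetworkCode.IsSteinerTree, edgeNum_code]
  refine and_congr ⟨fun h i hi => ?_, fun h i hi => ?_⟩
    (and_congr ⟨fun h i hi j hj hij => ?_, fun h i hi j hj => ?_⟩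
      ⟨fun h x hx => ?_, fun h x hx => ?_⟩)
  · rw [← serves_code, ← tail_code]
    exact (h i i.2).resolve_left (not_not.2 (mem_edgesOfBits.1 hi))
  · refine not_or_of_imp fun hT => ?_
    have := h ⟨i, hi⟩ (mem_edgesOfBits.2 hT)
    rwa [← serves_code, ← tail_code] at this
  · refine Fin.ext ((h i i.2 j j.2).resolve_left (not_not.2 ⟨mem_edgesOfBits.1 hi,
      mem_edgesOfBits.1 hj, ?_⟩))
    rw [head_code, head_code, hij]
  · refine not_or_of_imp fun ⟨hTi, hTj, hij⟩ => ?_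
    refine congrArg Fin.val (h ⟨i, hi⟩ (mem_edgesOfBits.2 hTi) ⟨j, hj⟩ (mem_edgesOfBits.2 hTj) ?_)
    rw [Fin.ext_iff, ← head_code, ← head_code]
    exact hij
  · rw [← serves_code]
    exact (h x x.2).resolve_left (not_not.2 ((N.isReceiver_code x k).2 hx))
  · refine not_or_of_imp fun hr => ?_
    have := h ⟨x, hx⟩ ((N.isReceiver_code ⟨x, hx⟩ k).1 hr)
    rwa [← serves_code] at this

theorem mem_trees_code (j : ℕ) : j ∈ N.code.trees ↔
    j < m * 2 ^ e ∧ N.code.IsSteinerTree (j / 2 ^ e) (j % 2 ^ e) := by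
  have : j ∈ N.code.trees ↔ j < m * 2 ^ N.code.edgeNum ∧
      N.code.IsSteinerTree (j / 2 ^ N.code.edgeNum) (j % 2 ^ N.code.edgeNum) := by
    simp only [trees, List.mem_filter, List.mem_range, decide_eq_true_iff]
    rfl
  rwa [edgeNum_code] at this

theorem treeIndex_ext {N : Network (Fin v) (Fin e) (Fin m) (Fin a)} {s t : N.TreeIndex}
    (h1 : (s.1 : ℕ) = t.1) (h2 : ∀ i, i ∈ s.2.1 ↔ i ∈ t.2.1) : s = t := by
  obtain ⟨k, T, hT⟩ := s
  obtain ⟨k', T', hT'⟩ := t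
  obtain rfl : k = k' := Fin.ext h1
  obtain rfl : T = T' := Finset.ext h2
  rfl

theorem exists_treeEquiv : ∃ φ : Fin N.code.dim ≃ N.TreeIndex,
    (∀ t, ((φ t).1 : ℕ) = N.code.msg t) ∧
      ∀ t (i : Fin e), i ∈ (φ t).2.1 ↔ N.code.inc i t = 1 := by
  have hget : ∀ t : Fin N.code.dim, N.code.trees.getD t 0 = N.code.trees.get t := by
    intro t
    have ht : (t : ℕ) < N.code.trees.length := t.2
    simp [List.getD_eq_getElem?_getD, ht]
    rfl
  have hmsg : ∀ t : Fin N.code.dim, N.code.msg t = N.code.trees.get t / 2 ^ e := by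
    intro t
    rw [msg, hget, edgeNum_code]
  have hinc : ∀ (t : Fin N.code.dim) i, N.code.inc i t = bit (N.code.trees.get t % 2 ^ e) i := by
    intro t i
    rw [inc, hget, edgeNum_code]
  have hex : ∀ t : Fin N.code.dim, ∃ s : N.TreeIndex, (s.1 : ℕ) = N.code.msg t ∧
      ∀ i : Fin e, i ∈ s.2.1 ↔ N.code.inc i t = 1 := by
    intro t
    obtain ⟨hlt, hst⟩ := (N.mem_trees_code _).1 (List.get_mem N.code.trees t)
    have hk := (Nat.div_lt_iff_lt_mul (by positivity)).2 hlt
    refine ⟨⟨⟨_, hk⟩, ⟨_, (N.isSteinerTree_code ⟨_, hk⟩ _).1 hst⟩⟩, (hmsg t).symm, fun i => ?_⟩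
    rw [hinc]
    exact mem_edgesOfBits
  choose F hF1 hF2 using hex
  have hnodup : N.code.trees.Nodup := by
    unfold trees
    exact List.nodup_range.filter _
  refine ⟨Equiv.ofBijective F ⟨fun t t' htt => ?_, fun s => ?_⟩, hF1, hF2⟩
  · have h1 : N.code.trees.get t / 2 ^ e = N.code.trees.get t' / 2 ^ e := by
      rw [← hmsg, ← hmsg, ← hF1, ← hF1, htt]
    have h2 : N.code.trees.get t % 2 ^ e = N.code.trees.get t' % 2 ^ e := by
      refine eq_of_bit_eq_one_iff (Nat.mod_lt _ (by positivity)) (Nat.mod_lt _ (by positivity))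
        fun i hi => ?_
      rw [← hinc, ← hinc, ← hF2 t ⟨i, hi⟩, ← hF2 t' ⟨i, hi⟩, htt]
    have h3 : N.code.trees.get t = N.code.trees.get t' := by
      rw [← Nat.div_add_mod (N.code.trees.get t) (2 ^ e), h1, h2, Nat.div_add_mod]
    exact hnodup.injective_get h3
  · obtain ⟨T, hT, hbits⟩ := exists_bits (n := e) fun i => ∃ hi : i < e, (⟨i, hi⟩ : Fin e) ∈ s.2.1
    have hset : edgesOfBits e T = s.2.1 := by
      ext i
      rw [mem_edgesOfBits, hbits i i.2]
      exact ⟨fun ⟨_, h⟩ => h, fun h => ⟨i.2, h⟩⟩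
    have hdiv : (s.1 * 2 ^ e + T) / 2 ^ e = s.1 := by
      rw [mul_comm, Nat.mul_add_div (by positivity), Nat.div_eq_of_lt hT, add_zero]
    have hmod : (s.1 * 2 ^ e + T) % 2 ^ e = T := by
      rw [mul_comm, Nat.mul_add_mod, Nat.mod_eq_of_lt hT]
    have hmem : (s.1 * 2 ^ e + T : ℕ) ∈ N.code.trees := by
      rw [mem_trees_code, hdiv, hmod, isSteinerTree_code, hset]
      refine ⟨?_, s.2.2⟩
      calc (s.1 * 2 ^ e + T : ℕ) < s.1 * 2 ^ e + 2 ^ e := by omega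
        _ = (s.1 + 1) * 2 ^ e := by ring
        _ ≤ m * 2 ^ e := Nat.mul_le_mul_right _ s.1.2
    obtain ⟨t, ht⟩ : ∃ t : Fin N.code.dim, N.code.trees.get t = s.1 * 2 ^ e + T :=
      List.get_of_mem hmem
    refine ⟨t, treeIndex_ext ?_ fun i => ?_⟩
    · rw [hF1, hmsg, ht, hdiv]
    · rw [hF2, hinc, ht, hmod, ← hset, mem_edgesOfBits]

variable {N}

theorem mem_packingPolytope_iff {φ : Fin N.code.dim ≃ N.TreeIndex}
    (hφ : ∀ t (i : Fin e), i ∈ (φ t).2.1 ↔ N.code.inc i t = 1) (x : N.TreeIndex → ℝ) :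
    x ∈ N.packingPolytope ↔ x ∘ φ ∈ N.code.feasibleSet := by
  classical
  refine and_congr ⟨fun h t => h _, fun h t => by simpa using h (φ.symm t)⟩ ?_
  rw [edgeNum_code, ← Fin.forall_iff (p := fun i => ∑ t : Fin N.code.dim,
    (N.code.inc i t : ℝ) * (x ∘ φ) t ≤ N.code.cap i)]
  refine forall_congr' fun i => ?_
  rw [← φ.sum_comp, cap_code]
  have : ∀ t : Fin N.code.dim, (N.code.inc i t : ℝ) = if i ∈ (φ t).2.1 then 1 else 0 := by
    intro t
    simp only [hφ]
    have h : N.code.inc i t = 0 ∨ N.code.inc i t = 1 := bit_eq_zero_or_one _ _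
    rcases h with h | h <;> simp [h]
  simp only [this, Function.comp_apply]
  convert Iff.rfl

theorem mem_extremePoints_packingPolytope_iff {φ : Fin N.code.dim ≃ N.TreeIndex}
    (hφ : ∀ t (i : Fin e), i ∈ (φ t).2.1 ↔ N.code.inc i t = 1) (x : N.TreeIndex → ℝ) :
    x ∈ N.packingPolytope.extremePoints ℝ ↔ x ∘ φ ∈ N.code.feasibleSet.extremePoints ℝ := by
  let L : (N.TreeIndex → ℝ) ≃ₗ[ℝ] (Fin N.code.dim → ℝ) := LinearEquiv.funCongrLeft ℝ ℝ φ
  have hL : L '' N.packingPolytope = N.code.feasibleSet := by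
    ext y
    constructor
    · rintro ⟨x, hx, rfl⟩
      exact (mem_packingPolytope_iff hφ x).1 hx
    · intro hy
      refine ⟨y ∘ φ.symm, (mem_packingPolytope_iff hφ _).2 ?_, ?_⟩
      · simpa [Function.comp_assoc] using hy
      · funext t
        simp [L, LinearEquiv.funCongrLeft_apply, LinearMap.funLeft_apply]
  rw [← hL, ← image_extremePoints]
  exact (L.injective.mem_set_image (a := x)).symm

theorem packingDescribes_packingCode {φ : Fin N.code.dim ≃ N.TreeIndex}
    (hφ1 : ∀ t, ((φ t).1 : ℕ) = N.code.msg t)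
    (hφ2 : ∀ t (i : Fin e), i ∈ (φ t).2.1 ↔ N.code.inc i t = 1) {w : VertexCert}
    (hw : 0 < w.2.2.2.1) {x : N.TreeIndex → ℝ}
    (hx : ∀ t, x (φ t) = (N.code.num w t : ℝ) / w.2.2.2.1) :
    PackingDescribes N (N.code.packingCode w) x := by
  refine ⟨List.ofFn φ, fun t => ?_, ?_⟩
  · rw [List.mem_ofFn]
    exact φ.surjective t
  · rw [List.forall₂_iff_get]
    refine ⟨by simp [packingCode], fun t ht ht' => ?_⟩
    have htd : t < N.code.dim := by simpa using ht'
    have h1 : (N.code.packingCode w).get ⟨t, ht⟩ = ((N.code.msg t,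
        (List.range N.code.edgeNum).map fun i => N.code.inc i t == 1),
        (N.code.num w t, w.2.2.2.1)) := by
      simp [packingCode]
    have h2 : (List.ofFn φ).get ⟨t, ht'⟩ = φ ⟨t, htd⟩ := by simp
    rw [h1, h2]
    refine ⟨Prod.ext (hφ1 ⟨t, htd⟩).symm ?_, hw, hx ⟨t, htd⟩⟩
    refine List.ext_getElem (by simp [edgeNum_code]) fun i hi hi' => ?_
    have hie : i < e := by simpa using hi'
    have := hφ2 ⟨t, htd⟩ ⟨i, hie⟩
    simp only [List.getElem_map, List.getElem_range, List.getElem_ofFn]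
    rw [Bool.eq_iff_iff, beq_iff_eq, decide_eq_true_iff]
    exact this.symm

/-- The vertex certificates describe the vertices of the packing polytope. -/
theorem listsPoints_packingCode {C : List VertexCert} (hC : N.code.Covers C) :
    ListsPoints (PackingDescribes N) ((N.code.vertexCerts C).map N.code.packingCode)
      (N.packingPolytope.extremePoints ℝ) := by
  obtain ⟨φ, hφ1, hφ2⟩ := N.exists_treeEquiv
  constructor
  · intro L hL
    obtain ⟨w, hw, rfl⟩ := List.mem_map.1 hL
    have hw' := (mem_vertexCerts.1 hw).2
    refine ⟨fun t => (N.code.num w (φ.symm t) : ℝ) / w.2.2.2.1,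
      (mem_extremePoints_packingPolytope_iff hφ2 _).2 ?_,
      packingDescribes_packingCode hφ1 hφ2 hw'.1.1 fun t => by rw [φ.symm_apply_apply]⟩
    convert hw'.mem_extremePoints using 2 with t
    simp
  · intro x hx
    obtain ⟨w, hw, hxw⟩ := hC.exists_vertexCert ((mem_extremePoints_packingPolytope_iff hφ2 x).1 hx)
    exact ⟨_, List.mem_map_of_mem hw,
      packingDescribes_packingCode hφ1 hφ2 (mem_vertexCerts.1 hw).2.1.1 hxw⟩

theorem rateMap_eq_of_code {φ : Fin N.code.dim ≃ N.TreeIndex}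
    (hφ1 : ∀ t, ((φ t).1 : ℕ) = N.code.msg t) {w : VertexCert} {x : N.TreeIndex → ℝ}
    (hx : ∀ t, x (φ t) = (N.code.num w t : ℝ) / w.2.2.2.1) (k : Fin m) :
    N.rateMap x k = (((N.code.rateCode w).1.getD k 0 : ℕ) : ℝ) / (N.code.rateCode w).2 := by
  have hk : (k : ℕ) < N.code.msgNum := k.2
  have h1 : (N.code.rateCode w).1.getD k 0 =
      ∑ t : Fin N.code.dim, if N.code.msg t = k then N.code.num w t else 0 := by
    rw [Finset.sum_fin_eq_sum_range, rateCode, List.getD_eq_getElem?_getD]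
    simp only [List.getElem?_map, List.getElem?_range hk, Option.map_some, Option.getD_some]
    refine Finset.sum_congr rfl fun t ht => ?_
    rw [dif_pos (Finset.mem_range.1 ht)]
  rw [h1, rateMap_apply_eq_sum, ← φ.sum_comp, Nat.cast_sum, Finset.sum_div]
  refine Finset.sum_congr rfl fun t _ => ?_
  simp only [hx, ← hφ1, Fin.ext_iff]
  split_ifs <;> simp [rateCode]

/-- The images of the vertices of the packing polytope. -/
theorem range_point_eq {C : List VertexCert} (hC : N.code.Covers C) :
    Set.range (PointsCode.point (m, (N.code.vertexCerts C).map N.code.rateCode)) =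
      N.rateMap '' N.packingPolytope.extremePoints ℝ := by
  obtain ⟨φ, hφ1, hφ2⟩ := N.exists_treeEquiv
  have hlen : PointsCode.size (m, (N.code.vertexCerts C).map N.code.rateCode) =
      (N.code.vertexCerts C).length := by simp [PointsCode.size]
  have hpoint : ∀ i (hi : i < (N.code.vertexCerts C).length) (k : Fin m),
      PointsCode.point (m, (N.code.vertexCerts C).map N.code.rateCode) ⟨i, hlen ▸ hi⟩ k =
      (((N.code.rateCode (N.code.vertexCerts C)[i]).1.getD k 0 : ℕ) : ℝ) /
        (N.code.rateCode (N.code.vertexCerts C)[i]).2 := by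
    intro i hi k
    simp [PointsCode.point, PointsCode.num, PointsCode.den, List.getD_eq_getElem?_getD, hi]
  ext y
  constructor
  · rintro ⟨⟨i, hi⟩, rfl⟩
    have hi' : i < (N.code.vertexCerts C).length := hlen ▸ hi
    let w := (N.code.vertexCerts C)[i]
    have hw : N.code.IsVertexCert w := (mem_vertexCerts.1 (List.getElem_mem hi')).2
    refine ⟨fun t => (N.code.num w (φ.symm t) : ℝ) / w.2.2.2.1,
      (mem_extremePoints_packingPolytope_iff hφ2 _).2 ?_, funext fun k => ?_⟩
    · convert hw.mem_extremePoints using 2 with t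
      simp
    · rw [hpoint i hi' k]
      exact rateMap_eq_of_code hφ1 (fun t => by rw [φ.symm_apply_apply]) k
  · rintro ⟨x, hx, rfl⟩
    obtain ⟨w, hw, hxw⟩ := hC.exists_vertexCert ((mem_extremePoints_packingPolytope_iff hφ2 x).1 hx)
    obtain ⟨i, hi, rfl⟩ := List.getElem_of_mem hw
    refine ⟨⟨i, hlen.symm ▸ hi⟩, funext fun k => ?_⟩
    rw [hpoint i hi k]
    exact (rateMap_eq_of_code hφ1 hxw k).symm

theorem den_ne_zero (C : List VertexCert) : ∀ i < PointsCode.size (m, (N.code.vertexCerts C).map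
    N.code.rateCode), PointsCode.den (m, (N.code.vertexCerts C).map N.code.rateCode) i ≠ 0 := by
  intro i hi
  have hi' : i < (N.code.vertexCerts C).length := by simpa [PointsCode.size] using hi
  have hw : N.code.IsVertexCert (N.code.vertexCerts C)[i] :=
    (mem_vertexCerts.1 (List.getElem_mem hi')).2
  have : PointsCode.den (m, (N.code.vertexCerts C).map N.code.rateCode) i =
      (N.code.vertexCerts C)[i].2.2.2.1 := by
    simp [PointsCode.den, rateCode, List.getD_eq_getElem?_getD, hi']
  rw [this]
  exact hw.1.1.ne'

end Code

end Network

namespace NetworkCode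

/-- The images of the vertices of the packing polytope that are given by certificates. -/
noncomputable def ratePoints (c : NetworkCode) (C : List VertexCert) : PointsCode :=
  (c.msgNum, (c.vertexCerts C).map fun w => c.rateCode w)

/-- The vertices of the packing polytope that are given by certificates. -/
noncomputable def packingVertices (c : NetworkCode) (C : List VertexCert) : List PackingCode :=
  (c.vertexCerts C).map fun w => c.packingCode w

@[fun_prop]
theorem primrec_ratePoints :
    Primrec fun p : NetworkCode × List VertexCert => ratePoints p.1 p.2 := by
  unfold ratePoints; fun_prop

@[fun_prop]
theorem primrec_packingVertices :
    Primrec fun p : NetworkCode × List VertexCert => packingVertices p.1 p.2 := by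
  unfold packingVertices; fun_prop

theorem computable_ratePoints {f : NetworkCode → List VertexCert} (hf : Computable f) :
    Computable fun c => ratePoints c (f c) := by
  have h := Computable.comp primrec_ratePoints.to_comp (Computable.id.pair hf)
  exact h

theorem computable_packingVertices {f : NetworkCode → List VertexCert} (hf : Computable f) :
    Computable fun c => packingVertices c (f c) := by
  have h := Computable.comp primrec_packingVertices.to_comp (Computable.id.pair hf)
  exact h

end NetworkCode

theorem PointsCode.computable_vertices {p : NetworkCode → PointsCode}
    {D : NetworkCode → List HullCert} (hp : Computable p) (hD : Computable D) :
    Computable fun c => (p c).vertices (D c) := by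
  have h1 : Primrec fun p : PointsCode × List HullCert => p.1.vertices p.2 := by
    fun_prop
  have h := Computable.comp h1.to_comp (hp.pair hD)
  exact h

theorem theorem2 :
    -- the region is a bounded rational polytope, the image of the packing polytope
    (∀ {V E M A : Type*} [Finite V] [Fintype E] [Fintype M] [Finite A] (N : Network V E M A),
      N.Nondegenerate → N.AllDemanded →
        (∀ y ∈ N.routingRegion, ∀ m, 0 ≤ y m) ∧
        IsBoundedRationalPolytope N.routingRegion ∧
        (∀ y ∈ Set.extremePoints ℝ N.routingRegion, IsRationalPoint y) ∧
        IsBoundedRationalPolytope N.packingPolytope ∧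
        (Set.extremePoints ℝ N.packingPolytope).Finite ∧
        (∀ x ∈ Set.extremePoints ℝ N.packingPolytope, IsRationalPoint x) ∧
        N.routingRegion = N.rateMap '' N.packingPolytope ∧
        N.routingRegion =
          convexHull ℝ (N.rateMap '' Set.extremePoints ℝ N.packingPolytope)) ∧
    -- from a network one can compute the vertices of the packing polytope and of the region
    (∃ (packingVertices : NetworkCode → List PackingCode)
        (regionVertices : NetworkCode → List VectorCode),
      Computable packingVertices ∧ Computable regionVertices ∧
      ∀ {v e m a : ℕ} (N : Network (Fin v) (Fin e) (Fin m) (Fin a)),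
        N.Nondegenerate → N.AllDemanded →
          ListsPoints (PackingDescribes N) (packingVertices N.code)
            (Set.extremePoints ℝ N.packingPolytope) ∧
          ListsPoints VectorDescribes (regionVertices N.code)
            (Set.extremePoints ℝ N.routingRegion)) := by
  constructor
  · intro V E M A _ _ _ _ N hN hd
    have h : ∀ t : N.TreeIndex, t.2.1.Nonempty := fun t => t.2.2.nonempty hN hd
    have hR := Network.routingRegion_eq_image hN h
    refine ⟨?_, hR ▸ Network.isBoundedRationalPolytope_image h,
      fun y hy => Network.isRationalPoint_of_mem_extremePoints_image h (hR ▸ hy),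
      .of_polyhedron _ _ N.packingPolytope_eq_polyhedron (Network.isBounded_packingPolytope h), ?_,
      fun x hx => Network.isRationalPoint_of_mem_extremePoints_packingPolytope hx, hR,
      hR.trans (Network.rateMap_image_eq_convexHull h)⟩
    · rw [hR]
      rintro _ ⟨x, hx, rfl⟩ m
      exact Finset.sum_nonneg fun T _ => hx.1 _
    · rw [N.packingPolytope_eq_polyhedron]
      exact finite_extremePoints_polyhedron _ _
  · obtain ⟨f, hf, hcov⟩ := exists_computable_selector (R := NetworkCode.Covers) (by fun_prop)
      NetworkCode.exists_covers
    obtain ⟨g, hg, hdec⟩ := exists_computable_selector (R := PointsCode.Decides) (by fun_prop)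
      PointsCode.exists_decides
    have hpoints := NetworkCode.computable_ratePoints hf
    refine ⟨_, _, NetworkCode.computable_packingVertices hf,
      PointsCode.computable_vertices hpoints (hg.comp hpoints), fun N hN hd => ⟨?_, ?_⟩⟩
    · exact Network.listsPoints_packingCode (hcov _)
    · have h : ∀ t : N.TreeIndex, t.2.1.Nonempty := fun t => t.2.2.nonempty hN hd
      rw [Network.routingRegion_eq_image hN h, Network.rateMap_image_eq_convexHull h,
        ← Network.range_point_eq (hcov _)]
      exact PointsCode.Decides.listsPoints (hdec _) (Network.den_ne_zero _)
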